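/- **Theorem (Bulk-edge correspondence for a time-periodic propagator).** Let $N\in\mathbb N$, let $\mathcal H_B=\ell^2(\mathbb Z^2)\otimes\mathbb C^N$ and $\mathcal H_E=\ell^2(\mathbb N\times\mathbb Z)\otimes\mathbb C^N$ (with $0\in\mathbb N$), and let $\iota:\mathcal H_E\to\mathcal H_B$ be the canonical injection (extension by zero). Let $T>0$ and let $H_B(t)$, $t\in\mathbb R$, be a bulk Hamiltonian, i.e. a family of bounded self-adjoint operators on $\mathcal H_B$ which is 1. time-periodic: $H_B(t+T)=H_B(t)$ for all $t$; 2. local: there are $\mu,C>0$ such that $\|\langle \mathbf m|H_B(t)|\mathbf n\rangle\|\le C e^{-\mu(|m_1-n_1|+|m_2-n_2|)}$ for all $t\in[0,T]$ and $\mathbf m,\mathbf n\in\mathbb Z^2$, where $\langle \mathbf m|H_B(t)|\mathbf n\rangle$ is the $N\times N$ matrix kernel and $\|\cdot\|$ the matrix operator norm; 3. strongly continuous in $t$ except possibly for jump discontinuities (at every $t$ the strong left and right limits exist). Let $H_E(t)=\iota^*H_B(t)\iota$ be the edge Hamiltonian, and let $U_B(t,s)$, $U_E(t,s)$ be the unitary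 propagators generated by $H_B$ and $H_E$: the two-parameter families of unitaries $U(t,s)$, strongly continuous in $(t,s)$, with $U(t,t)=I$, $U(t,r)U(r,s)=U(t,s)$, and $i\,\partial_t U(t,s)\psi=H(t)U(t,s)\psi$ for every $\psi$ at every $t$ at which $H$ is strongly continuous. Write $U(t)=U(t,0)$, and assume $U_B(T)=I$. A switch function is a function $\Lambda:\mathbb Z\to\mathbb R$ with $\Lambda(n)=1$ for all sufficiently large $n$ and $\Lambda(n)=0$ for all sufficiently negative $n$; a switch function $\Lambda_i$ in direction $i$ acts on $\mathcal H_B$ or $\mathcal H_E$ as multiplication by $\Lambda(n_i)$. Let $\Lambda_1,\Lambda_2$ be switch functions in directions $1,2$ on $\mathcal H_B$, and let $\Lambda_2'$ be any switch function in direction $2$ on $\mathcal H_E$. Then the bulk index $$\mathcal I_B=\frac12\int_0^T \mathrm{Tr}_{\mathcal H_B}\Big(U_B^*\,\partial_tU_B\,\big[U_B^*[\Lambda_1,U_B],\,U_B^*[\Lambda_2,U_B]\big]\Big)\,dt$$ and the edge index $$\mathcal I_E=\mathrm{Tr}_{\mathcal H_E}\Big(U_E^*(T)\,[\Lambda_2',U_E(T)]\Big)$$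 are well defined (the operators under the traces are trace class, and the trace is an integrable function of $t\in[0,T]$; $\partial_t U_B$ is the strong derivative, set to $0$ at the exceptional times where it does not exist), and $$\mathcal I_B=\mathcal I_E .$$ -/

import Mathlib

open Filter Topology MeasureTheory Set
open scoped InnerProductSpace ENNReal

noncomputable section

namespace Floquet

/-! ### The Hilbert spaces -/

/-- `ℓ²(S) ⊗ ℂ^N`, as the space of square summable `ℂ^N`-valued families on the set of sites `S`. -/
abbrev SiteSpace (S : Type) (N : ℕ) : Type :=
  lp (fun _ : S => EuclideanSpace ℂ (Fin N)) 2

/-- The bulk Hilbert space `ℓ²(ℤ²) ⊗ ℂ^N`. -/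
abbrev BulkSpace (N : ℕ) : Type := SiteSpace (ℤ × ℤ) N

/-- The edge Hilbert space `ℓ²(ℕ × ℤ) ⊗ ℂ^N`. -/
abbrev EdgeSpace (N : ℕ) : Type := SiteSpace (ℕ × ℤ) N

/-- The kernel `K_{m,n} = ⟨m| K |n⟩` of an operator, an endomorphism of `ℂ^N`;
its norm is the operator norm of matrices. -/
def kernel {S : Type} [DecidableEq S] {N : ℕ} (K : SiteSpace S N →L[ℂ] SiteSpace S N) (m n : S) :
    EuclideanSpace ℂ (Fin N) →L[ℂ] EuclideanSpace ℂ (Fin N) :=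
  (lp.evalCLM ℂ (fun _ : S => EuclideanSpace ℂ (Fin N)) 2 m) ∘L K ∘L
    (lp.singleContinuousLinearMap ℂ (fun _ : S => EuclideanSpace ℂ (Fin N)) 2 n)

/-! ### Trace class operators and the trace -/

/-- The state at site `p.1` with internal degree of freedom `p.2`. -/
def siteVec {S : Type} [DecidableEq S] {N : ℕ} (p : S × Fin N) : SiteSpace S N :=
  lp.single 2 p.1 (EuclideanSpace.single p.2 (1 : ℂ))

theorem orthonormal_siteVec (S : Type) [DecidableEq S] (N : ℕ) :
    Orthonormal ℂ (siteVec : S × Fin N → SiteSpace S N) := by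
  rw [orthonormal_iff_ite]
  rintro ⟨m, a⟩ ⟨n, b⟩
  rw [siteVec, siteVec, lp.inner_single_left, lp.single_apply]
  by_cases h : m = n
  · subst h
    simp [EuclideanSpace.inner_single_left, Prod.ext_iff]
  · simp [h, Prod.ext_iff]

theorem orthogonal_span_siteVec (S : Type) [DecidableEq S] (N : ℕ) :
    (Submodule.span ℂ (Set.range (siteVec : S × Fin N → SiteSpace S N)))ᗮ = ⊥ := by
  rw [Submodule.eq_bot_iff]
  intro f hf
  ext m a
  have h := (Submodule.mem_orthogonal _ f).1 hf (siteVec (m, a))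
    (Submodule.subset_span ⟨(m, a), rfl⟩)
  rw [siteVec, lp.inner_single_left] at h
  simpa [EuclideanSpace.inner_single_left] using h

/-- The orthonormal basis of `ℓ²(S) ⊗ ℂ^N` consisting of the states `siteVec`. -/
def siteBasis (S : Type) [DecidableEq S] (N : ℕ) : HilbertBasis (S × Fin N) ℂ (SiteSpace S N) :=
  HilbertBasis.mkOfOrthogonalEqBot (orthonormal_siteVec S N) (orthogonal_span_siteVec S N)

/-- The absolute value `|A| = (A* A)^{1/2}`. -/
def absOp {E : Type} [NormedAddCommGroup E] [InnerProductSpace ℂ E] [CompleteSpace E]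
    (A : E →L[ℂ] E) : E →L[ℂ] E :=
  CFC.abs A

/-- `A` is trace class: `Tr |A| < ∞`. As `|A|` is positive, the trace
may be computed in any orthonormal basis. -/
def IsTraceClass {S : Type} [DecidableEq S] {N : ℕ} (A : SiteSpace S N →L[ℂ] SiteSpace S N) :
    Prop :=
  Summable fun p => (⟪siteBasis S N p, absOp A (siteBasis S N p)⟫_ℂ).re

/-- The trace `Tr A = ∑ ⟨e, A e⟩` over an orthonormal basis (meaningful for trace class `A`,
for which the choice of the basis is immaterial). -/
def trace {S : Type} [DecidableEq S] {N : ℕ} (A : SiteSpace S N →L[ℂ] SiteSpace S N) : ℂ :=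
  ∑' p, ⟪siteBasis S N p, A (siteBasis S N p)⟫_ℂ

/-! ### Bulk and edge Hamiltonians -/

/-- `|m - n| = |m₁ - n₁| + |m₂ - n₂|` on `ℤ²`. -/
def dist1 (m n : ℤ × ℤ) : ℝ := |(m.1 : ℝ) - n.1| + |(m.2 : ℝ) - n.2|

/-- Bulk Hamiltonians of period `T`. -/
structure IsBulkHamiltonian {N : ℕ} (T : ℝ) (H : ℝ → BulkSpace N →L[ℂ] BulkSpace N) : Prop where
  selfAdjoint : ∀ t, IsSelfAdjoint (H t)
  periodic : ∀ t, H (t + T) = H t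
  isLocal : ∃ μ > 0, ∃ C > 0, ∀ t ∈ Icc 0 T, ∀ m n : ℤ × ℤ,
    ‖kernel (H t) m n‖ ≤ C * Real.exp (-μ * dist1 m n)
  /-- Strongly continuous except possibly for jump discontinuities. -/
  piecewiseContinuous : ∀ (t : ℝ) (ψ : BulkSpace N),
    (∃ φ, Tendsto (fun τ => H τ ψ) (𝓝[<] t) (𝓝 φ)) ∧
      (∃ φ, Tendsto (fun τ => H τ ψ) (𝓝[>] t) (𝓝 φ))

/-- The inclusion `ℕ × ℤ ⊆ ℤ²`. -/
def siteIncl (n : ℕ × ℤ) : ℤ × ℤ := ((n.1 : ℤ), n.2)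

theorem siteIncl_injective : Function.Injective siteIncl := by
  rintro ⟨a, b⟩ ⟨c, d⟩ h
  simpa [siteIncl, Prod.ext_iff] using h

theorem hasSum_extend_sq {N : ℕ} (f : EdgeSpace N) :
    HasSum (fun m => ‖Function.extend siteIncl (⇑f) 0 m‖ ^ (2 : ℝ≥0∞).toReal)
      (‖f‖ ^ (2 : ℝ≥0∞).toReal) := by
  have h := lp.hasSum_norm (p := 2) (by norm_num) f
  refine (siteIncl_injective.hasSum_iff (fun m hm => ?_)).1 ?_
  · rw [Function.extend_apply' _ _ _ (fun ⟨a, ha⟩ => hm ⟨a, ha⟩)]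
    simp
  · simpa [Function.comp_def, siteIncl_injective.extend_apply] using h

/-- The canonical injection `ι` of the edge space into the bulk space (extension by zero). -/
def inj (N : ℕ) : EdgeSpace N →L[ℂ] BulkSpace N :=
  LinearIsometry.toContinuousLinearMap
    { toFun := fun f => ⟨Function.extend siteIncl (⇑f) 0,
        memℓp_gen (hasSum_extend_sq f).summable⟩
      map_add' := fun f g => by
        ext1
        change Function.extend siteIncl (⇑f + ⇑g) 0 =
          Function.extend siteIncl (⇑f) 0 + Function.extend siteIncl (⇑g) 0
        rw [← Function.extend_add, add_zero]
      map_smul' := fun c f => by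
        ext1
        change Function.extend siteIncl (c • ⇑f) 0 = c • Function.extend siteIncl (⇑f) 0
        rw [← Function.extend_smul, smul_zero]
      norm_map' := fun f => by
        have h1 := lp.hasSum_norm (p := 2) (by norm_num)
          (⟨Function.extend siteIncl (⇑f) 0, memℓp_gen (hasSum_extend_sq f).summable⟩ : BulkSpace N)
        have h2 := h1.unique (hasSum_extend_sq f)
        exact (Real.rpow_left_inj (norm_nonneg _) (norm_nonneg _) (by norm_num)).1 h2 }

/-- The edge Hamiltonian `H_E(t) = ι* H_B(t) ι`. -/
def edgeHamiltonian {N : ℕ} (H : ℝ → BulkSpace N →L[ℂ] BulkSpace N) (t : ℝ) :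
    EdgeSpace N →L[ℂ] EdgeSpace N :=
  (ContinuousLinearMap.adjoint (inj N)) ∘L H t ∘L inj N

/-! ### Propagators -/

/-- `U(t,s)` is the unitary propagator generated by `H(t)`. The Schrödinger equation
`i ∂ₜ U(t,s)ψ = H(t) U(t,s)ψ` is required at all times `t` at which `H` is strongly continuous;
across the jumps `U` is determined by strong continuity. -/
structure IsPropagator {E : Type} [NormedAddCommGroup E] [InnerProductSpace ℂ E] [CompleteSpace E]
    (H : ℝ → E →L[ℂ] E) (U : ℝ → ℝ → E →L[ℂ] E) : Prop where
  unitary : ∀ t s, U t s ∈ _root_.unitary (E →L[ℂ] E)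
  refl : ∀ t, U t t = 1
  comp : ∀ t r s, U t r * U r s = U t s
  continuous : ∀ ψ, Continuous fun p : ℝ × ℝ => U p.1 p.2 ψ
  schrodinger : ∀ t s ψ, (∀ φ, ContinuousAt (fun τ => H τ φ) t) →
    HasDerivAt (fun τ => Complex.I • U τ s ψ) (H t (U t s ψ)) t

/-- `A'` is the derivative of the operator family `A` at `t` in the strong sense. -/
def HasStrongDerivAt {E : Type} [NormedAddCommGroup E] [NormedSpace ℂ E]
    (A : ℝ → E →L[ℂ] E) (A' : E →L[ℂ] E) (t : ℝ) : Prop :=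
  ∀ ψ, HasDerivAt (fun τ => A τ ψ) (A' ψ) t

open Classical in
/-- The strong derivative `∂ₜ A` (zero at the times where it does not exist). -/
def strongDeriv {E : Type} [NormedAddCommGroup E] [NormedSpace ℂ E]
    (A : ℝ → E →L[ℂ] E) (t : ℝ) : E →L[ℂ] E :=
  if h : ∃ A', HasStrongDerivAt A A' t then h.choose else 0

theorem HasStrongDerivAt.strongDeriv_eq {E : Type} [NormedAddCommGroup E] [NormedSpace ℂ E]
    {A : ℝ → E →L[ℂ] E} {A' : E →L[ℂ] E} {t : ℝ} (h : HasStrongDerivAt A A' t) :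
    strongDeriv A t = A' := by
  have hex : ∃ A', HasStrongDerivAt A A' t := ⟨A', h⟩
  rw [strongDeriv, dif_pos hex]
  ext ψ
  exact (hex.choose_spec ψ).unique (h ψ)

/-! ### Switch functions and the indices -/

/-- Switch functions `Λ : ℤ → ℝ`. -/
structure SwitchFunction where
  toFun : ℤ → ℝ
  eventually_one : ∀ᶠ n in atTop, toFun n = 1
  eventually_zero : ∀ᶠ n in atBot, toFun n = 0

theorem SwitchFunction.bounded (Λ : SwitchFunction) : ∃ C : ℝ, 0 ≤ C ∧ ∀ n, |Λ.toFun n| ≤ C := by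
  obtain ⟨a, ha⟩ := eventually_atTop.1 Λ.eventually_one
  obtain ⟨b, hb⟩ := eventually_atBot.1 Λ.eventually_zero
  refine ⟨1 + ∑ n ∈ Finset.Icc b a, |Λ.toFun n|, by positivity, fun n => ?_⟩
  have hs : 0 ≤ ∑ n ∈ Finset.Icc b a, |Λ.toFun n| := by positivity
  rcases le_total a n with h | h
  · rw [ha n h, abs_one]; linarith
  rcases le_total n b with h' | h'
  · rw [hb n h', abs_zero]; linarith
  · have := Finset.single_le_sum (f := fun n => |Λ.toFun n|) (fun i _ => abs_nonneg _)
      (Finset.mem_Icc.2 ⟨h', h⟩)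
    linarith

/-- The multiplication operator by `Λ(c(n))`, where `c(n)` is an integer coordinate of the
site `n`. -/
def switchOp {S : Type} (N : ℕ) (c : S → ℤ) (Λ : SwitchFunction) :
    SiteSpace S N →L[ℂ] SiteSpace S N :=
  lp.mapCLM 2 (fun n : S => (Λ.toFun (c n) : ℂ) •
      ContinuousLinearMap.id ℂ (EuclideanSpace ℂ (Fin N)))
    (K := Λ.bounded.choose) Λ.bounded.choose_spec.1 (fun n => by
      refine (norm_smul_le _ _).trans ?_
      rw [Complex.norm_real, Real.norm_eq_abs]
      calc _ ≤ |Λ.toFun (c n)| * 1 :=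
            mul_le_mul_of_nonneg_left ContinuousLinearMap.norm_id_le (abs_nonneg _)
        _ ≤ _ := by rw [mul_one]; exact Λ.bounded.choose_spec.2 _)

theorem switchOp_apply {S : Type} (N : ℕ) (c : S → ℤ) (Λ : SwitchFunction) (ψ : SiteSpace S N)
    (n : S) : switchOp N c Λ ψ n = (Λ.toFun (c n) : ℂ) • ψ n := by
  rfl

/-- The operator `U* ∂ₜU [U*[Λ₁,U], U*[Λ₂,U]]` at time `t`, for `U(t) = U_B(t,0)`. -/
def bulkOp {N : ℕ} (U : ℝ → ℝ → BulkSpace N →L[ℂ] BulkSpace N) (Λ₁ Λ₂ : SwitchFunction) (t : ℝ) :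
    BulkSpace N →L[ℂ] BulkSpace N :=
  star (U t 0) * strongDeriv (fun τ => U τ 0) t *
    ⁅star (U t 0) * ⁅switchOp N (fun n : ℤ × ℤ => n.1) Λ₁, U t 0⁆,
      star (U t 0) * ⁅switchOp N (fun n : ℤ × ℤ => n.2) Λ₂, U t 0⁆⁆

/-- The bulk index. -/
def bulkIndex {N : ℕ} (T : ℝ) (U : ℝ → ℝ → BulkSpace N →L[ℂ] BulkSpace N)
    (Λ₁ Λ₂ : SwitchFunction) : ℂ :=
  (1 / 2) * ∫ t in (0 : ℝ)..T, trace (bulkOp U Λ₁ Λ₂ t)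

/-- The operator `U_E*(T) [Λ₂, U_E(T)]`, for `U_E(T) = U_E(T,0)`. -/
def edgeOp {N : ℕ} (T : ℝ) (U : ℝ → ℝ → EdgeSpace N →L[ℂ] EdgeSpace N) (Λ₂ : SwitchFunction) :
    EdgeSpace N →L[ℂ] EdgeSpace N :=
  star (U T 0) * ⁅switchOp N (fun n : ℕ × ℤ => n.2) Λ₂, U T 0⁆

/-- The edge index. -/
def edgeIndex {N : ℕ} (T : ℝ) (U : ℝ → ℝ → EdgeSpace N →L[ℂ] EdgeSpace N)
    (Λ₂ : SwitchFunction) : ℂ :=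
  trace (edgeOp T U Λ₂)

end Floquet

end

set_option linter.unusedSectionVars false

/-! Both indices are integrated fluxes. For commuting observables `L`, `M` put `flux = Tr ([H, L] (M
- U M U*))`, with `U` the bulk evolution. Exponential locality of `H` passes to `U`
(`IsEvolution.localized`), so a commutator with a switch function in one direction decays along that
direction. A product of one such factor for each direction decays away from the origin, hence is
trace class and obeys cyclicity of the trace.

Bulk side: since `L` and `M` commute, algebra and cyclicity turn the bulk trace into `-i (flux L M -
flux M L)` (`opTrace_bulk`). The fundamental theorem of calculus under the trace is applied to `(U*
L U - L)(U* M U - M)`, which vanishes at `0` and, by periodicity of `U`, at `T`. Hence the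
integrated flux is antisymmetric (`integral_flux_antisymm`) and the bulk index is `-i ∫ flux L M`.
Applied to `(U* L U - L)(M - M')` the same argument shows that the integrated flux does not depend
on the switch function `M` (`integral_flux_congr`), nor, by antisymmetry, on `L`.

Edge side: the edge evolution is extended by the identity to a bulk unitary `V` generated by `P H
P`, where `P` projects onto the half space. The operator `P (V* U M U* V - M) P` vanishes at `t =
0`, and at `t = T` it is the edge operator because `U T = 1`. Its derivative contains `H` only
through the corners `P H (1 - P)` and `(1 - P) H P`, which live near the boundary, and has trace `-i
flux P M` (`deriv_defect`, `opTrace_source`). The edge index is therefore `-i ∫ flux P M`.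

The two sides meet because `P` is itself multiplication by a switch function in direction 1
(`isSwitch_halfSpace`). All derivatives are strong and exist off a countable set of times, which is
enough for the calculus of matrix elements. -/

namespace Floquet

/-! ### Calculus of strongly differentiable operator families. -/

section StrongCalculus

variable {E : Type} [NormedAddCommGroup E] [InnerProductSpace ℂ E] [CompleteSpace E]

/-- Joint strong convergence: a bounded, strongly convergent family of operators applied to a
convergent family of vectors. -/
theorem tendsto_clm_apply {l : Filter ℝ} {F : ℝ → E →L[ℂ] E} {F₀ : E →L[ℂ] E} {v : ℝ → E} {v₀ : E}
    {C : ℝ} (hb : ∀ᶠ τ in l, ‖F τ‖ ≤ C) (hF : ∀ ψ, Tendsto (fun τ => F τ ψ) l (𝓝 (F₀ ψ)))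
    (hv : Tendsto v l (𝓝 v₀)) : Tendsto (fun τ => F τ (v τ)) l (𝓝 (F₀ v₀)) := by
  have h1 : Tendsto (fun τ => F τ (v τ - v₀)) l (𝓝 0) := by
    have h0 : Tendsto (fun τ => C * ‖v τ - v₀‖) l (𝓝 0) := by
      simpa using (tendsto_iff_norm_sub_tendsto_zero.1 hv).const_mul C
    refine squeeze_zero_norm' ?_ h0
    filter_upwards [hb] with τ hτ
    exact (F τ).le_of_opNorm_le hτ _
  simpa using h1.add (hF v₀)

theorem HasStrongDerivAt.mul {F G : ℝ → E →L[ℂ] E} {F' G' : E →L[ℂ] E} {t C : ℝ}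
    (hF : HasStrongDerivAt F F' t) (hG : HasStrongDerivAt G G' t)
    (hb : ∀ᶠ τ in 𝓝 t, ‖F τ‖ ≤ C) :
    HasStrongDerivAt (fun τ => F τ * G τ) (F' * G t + F t * G') t := by
  intro ψ
  have h1 := hasDerivAt_iff_tendsto_slope.1 (hF (G t ψ))
  have h2 := hasDerivAt_iff_tendsto_slope.1 (hG ψ)
  have h3 := tendsto_clm_apply (F := F) (F₀ := F t) (hb.filter_mono nhdsWithin_le_nhds)
    (fun φ => (hF φ).continuousAt.tendsto.mono_left nhdsWithin_le_nhds) h2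
  refine hasDerivAt_iff_tendsto_slope.2 ((h1.add h3).congr fun τ => ?_)
  simp only [slope, vsub_eq_sub, mul_apply_eq_comp, ContinuousLinearMap.map_smul_of_tower, map_sub]
  rw [← smul_add]
  congr 1
  abel

theorem HasStrongDerivAt.sub {F G : ℝ → E →L[ℂ] E} {F' G' : E →L[ℂ] E} {t : ℝ}
    (hF : HasStrongDerivAt F F' t) (hG : HasStrongDerivAt G G' t) :
    HasStrongDerivAt (fun τ => F τ - G τ) (F' - G') t := fun ψ => (hF ψ).sub (hG ψ)

theorem hasStrongDerivAt_const (K : E →L[ℂ] E) (t : ℝ) :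
    HasStrongDerivAt (fun _ => K) 0 t := fun ψ => hasDerivAt_const t (K ψ)

theorem HasStrongDerivAt.const_mul {F : ℝ → E →L[ℂ] E} {F' : E →L[ℂ] E} {t : ℝ}
    (K : E →L[ℂ] E) (hF : HasStrongDerivAt F F' t) :
    HasStrongDerivAt (fun τ => K * F τ) (K * F') t :=
  fun ψ => (K.restrictScalars ℝ).hasFDerivAt.comp_hasDerivAt t (hF ψ)

theorem HasStrongDerivAt.mul_const {F : ℝ → E →L[ℂ] E} {F' : E →L[ℂ] E} {t : ℝ}
    (hF : HasStrongDerivAt F F' t) (K : E →L[ℂ] E) :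
    HasStrongDerivAt (fun τ => F τ * K) (F' * K) t := fun ψ => hF (K ψ)

theorem norm_le_one_of_mem_unitary {U : E →L[ℂ] E} (h : U ∈ unitary (E →L[ℂ] E)) : ‖U‖ ≤ 1 := by
  rcases subsingleton_or_nontrivial E with _ | _
  · simp [Subsingleton.elim U 0]
  · exact (CStarRing.norm_of_mem_unitary h).le

/-- Adjoints need not inherit strong derivatives. For unitaries they do, through `U(τ)* - U(t)* =
-U(τ)* (U(τ) - U(t)) U(t)*` and strong continuity of `U*`. -/
theorem HasStrongDerivAt.star_of_unitary {U : ℝ → E →L[ℂ] E} {U' : E →L[ℂ] E} {t : ℝ}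
    (hU : HasStrongDerivAt U U' t) (hu : ∀ τ, U τ ∈ unitary (E →L[ℂ] E))
    (hc : ∀ ψ, Continuous fun τ => star (U τ) ψ) :
    HasStrongDerivAt (fun τ => star (U τ)) (-(star (U t) * U' * star (U t))) t := by
  intro ψ
  have h2 := hasDerivAt_iff_tendsto_slope.1 (hU (star (U t) ψ))
  have h3 := (tendsto_clm_apply (F := fun τ => star (U τ)) (F₀ := star (U t)) (C := 1)
    (Eventually.of_forall fun τ => norm_le_one_of_mem_unitary (Unitary.star_mem (hu τ)))
    (fun φ => ((hc φ).tendsto t).mono_left nhdsWithin_le_nhds) h2).neg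
  refine hasDerivAt_iff_tendsto_slope.2 (h3.congr fun τ => ?_)
  have e1 : ∀ s φ, star (U s) (U s φ) = φ := fun s φ => by
    rw [← mul_apply_eq_comp, (Unitary.mem_iff.1 (hu s)).1]; rfl
  have e2 : U t (star (U t) ψ) = ψ := by
    rw [← mul_apply_eq_comp, (Unitary.mem_iff.1 (hu t)).2]; rfl
  simp only [slope, vsub_eq_sub, ContinuousLinearMap.map_smul_of_tower, map_sub, e1, e2]
  rw [← smul_neg, neg_sub]

end StrongCalculus

/-! ### Bounded families, strongly continuous off an exceptional set. -/

section Regularity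

variable {E : Type} [NormedAddCommGroup E] [InnerProductSpace ℂ E] [CompleteSpace E]

/-- A family of operators that is bounded on `[0,T]` and strongly continuous on `(0,T)` away from
the exceptional set `Z`. -/
structure StronglyRegular (Z : Set ℝ) (T : ℝ) (F : ℝ → E →L[ℂ] E) : Prop where
  bound : ∃ C, ∀ t ∈ Icc 0 T, ‖F t‖ ≤ C
  cont : ∀ t ∈ Ioo 0 T \ Z, ∀ ψ, ContinuousAt (fun τ => F τ ψ) t

variable {Z : Set ℝ} {T : ℝ} {F G : ℝ → E →L[ℂ] E}

theorem StronglyRegular.eventually_bound (hF : StronglyRegular Z T F) :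
    ∃ C, ∀ t ∈ Ioo 0 T, ∀ᶠ τ in 𝓝 t, ‖F τ‖ ≤ C := by
  obtain ⟨C, hC⟩ := hF.bound
  exact ⟨C, fun t ht => mem_of_superset (Ioo_mem_nhds ht.1 ht.2) fun τ hτ =>
    hC τ (Ioo_subset_Icc_self hτ)⟩

theorem StronglyRegular.mul (hF : StronglyRegular Z T F) (hG : StronglyRegular Z T G) :
    StronglyRegular Z T (fun t => F t * G t) := by
  refine ⟨?_, fun t ht ψ => ?_⟩
  · obtain ⟨C, hC⟩ := hF.bound
    obtain ⟨C', hC'⟩ := hG.bound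
    exact ⟨C * C', fun t ht => (norm_mul_le _ _).trans
      (mul_le_mul (hC t ht) (hC' t ht) (norm_nonneg _) ((norm_nonneg _).trans (hC t ht)))⟩
  · obtain ⟨C, hC⟩ := hF.eventually_bound
    exact tendsto_clm_apply (F := F) (F₀ := F t) (v₀ := G t ψ) (hC t ht.1)
      (fun φ => hF.cont t ht φ) (hG.cont t ht ψ)

theorem StronglyRegular.add (hF : StronglyRegular Z T F) (hG : StronglyRegular Z T G) :
    StronglyRegular Z T (fun t => F t + G t) := by
  refine ⟨?_, fun t ht ψ => (hF.cont t ht ψ).add (hG.cont t ht ψ)⟩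
  obtain ⟨C, hC⟩ := hF.bound
  obtain ⟨C', hC'⟩ := hG.bound
  exact ⟨C + C', fun t ht => norm_add_le_of_le (hC t ht) (hC' t ht)⟩

theorem StronglyRegular.sub (hF : StronglyRegular Z T F) (hG : StronglyRegular Z T G) :
    StronglyRegular Z T (fun t => F t - G t) := by
  refine ⟨?_, fun t ht ψ => (hF.cont t ht ψ).sub (hG.cont t ht ψ)⟩
  obtain ⟨C, hC⟩ := hF.bound
  obtain ⟨C', hC'⟩ := hG.bound
  exact ⟨C + C', fun t ht => norm_sub_le_of_le (hC t ht) (hC' t ht)⟩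

theorem stronglyRegular_const (K : E →L[ℂ] E) : StronglyRegular Z T (fun _ => K) :=
  ⟨⟨‖K‖, fun _ _ => le_rfl⟩, fun _ _ _ => continuousAt_const⟩

theorem StronglyRegular.const_smul (hF : StronglyRegular Z T F) (c : ℂ) :
    StronglyRegular Z T (fun t => c • F t) := by
  simpa using (stronglyRegular_const (Z := Z) (T := T) (c • (1 : E →L[ℂ] E))).mul hF

theorem StronglyRegular.aestronglyMeasurable_inner (hF : StronglyRegular Z T F)
    (hZ : Z.Countable) (φ ψ : E) :
    AEStronglyMeasurable (fun t => ⟪φ, F t ψ⟫_ℂ) (volume.restrict (Ioo 0 T)) := by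
  have h1 : ContinuousOn (fun t => ⟪φ, F t ψ⟫_ℂ) (Ioo 0 T \ Z) := fun t ht =>
    (continuousAt_const.inner (𝕜 := ℂ) (hF.cont t ht ψ)).continuousWithinAt
  have h2 := h1.aestronglyMeasurable (μ := volume) (measurableSet_Ioo.diff hZ.measurableSet)
  rwa [Measure.restrict_congr_set (sdiff_null_ae_eq_self (hZ.measure_zero _))] at h2

end Regularity

/-! ### Functions with one-sided limits. -/

section Jumps

variable {E : Type} [NormedAddCommGroup E]

/-- A function with one-sided limits everywhere has at most countably many discontinuities. -/
theorem countable_not_continuousAt_of_jumps {f : ℝ → E}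
    (hl : ∀ t, ∃ φ, Tendsto f (𝓝[<] t) (𝓝 φ)) (hr : ∀ t, ∃ φ, Tendsto f (𝓝[>] t) (𝓝 φ)) :
    {t | ¬ ContinuousAt f t}.Countable := by
  -- A one-sided limit makes `f` nearly constant on a punctured neighbourhood of each point, so
  -- every `D k` is discrete; the Lindelöf property then makes it countable.
  let D : ℕ → Set ℝ := fun k => {t | ¬ ∀ᶠ τ in 𝓝 t, ‖f τ - f t‖ < 1 / ((k : ℝ) + 1)}
  have hsub : {t | ¬ ContinuousAt f t} ⊆ ⋃ k, D k := by
    intro t ht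
    by_contra hn
    simp only [D, mem_iUnion, mem_ofPred_eq, not_exists, not_not] at hn
    refine ht (Metric.tendsto_nhds.2 fun ε hε => ?_)
    obtain ⟨k, hk⟩ := exists_nat_one_div_lt hε
    filter_upwards [hn k] with τ hτ
    rw [dist_eq_norm]
    exact hτ.trans hk
  refine (countable_iUnion fun k => ?_).mono hsub
  have hε : (0 : ℝ) < 1 / ((k : ℝ) + 1) := by positivity
  have key : ∀ (t : ℝ) (u : Set ℝ), IsOpen u → (∃ φ, Tendsto f (𝓝[u] t) (𝓝 φ)) →
      ∀ᶠ s in 𝓝[u] t, s ∉ D k := by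
    rintro t u hu ⟨φ, hφ⟩
    have h1 : ∀ᶠ s in 𝓝[u] t, ‖f s - φ‖ < 1 / ((k : ℝ) + 1) / 2 := by
      filter_upwards [Metric.tendsto_nhds.1 hφ _ (half_pos hε)] with s hs
      rwa [dist_eq_norm] at hs
    have h2 := eventually_eventually_nhdsWithin.2 h1
    filter_upwards [h2, self_mem_nhdsWithin] with s hs hsu
    -- At a point of the open half line, one-sided neighbourhoods are full neighbourhoods.
    rw [hu.nhdsWithin_eq hsu] at hs
    simp only [D, mem_ofPred_eq, not_not]
    filter_upwards [hs] with τ hτ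
    have h3 := hs.self_of_nhds
    calc ‖f τ - f s‖ = ‖(f τ - φ) - (f s - φ)‖ := by rw [sub_sub_sub_cancel_right]
      _ ≤ ‖f τ - φ‖ + ‖f s - φ‖ := norm_sub_le _ _
      _ < _ := by linarith
  have hnhd : ∀ t, {s | s ∉ D k ∨ s = t} ∈ 𝓝 t := by
    intro t
    have h1 := key t (Iio t) isOpen_Iio (hl t)
    have h2 := key t (Ioi t) isOpen_Ioi (hr t)
    have h3 : ∀ᶠ s in 𝓝[≠] t, s ∉ D k := by
      rw [← Iio_union_Ioi, nhdsWithin_union, eventually_sup]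
      exact ⟨h1, h2⟩
    rw [eventually_nhdsWithin_iff] at h3
    filter_upwards [h3] with s hs
    by_cases h : s = t
    · exact Or.inr h
    · exact Or.inl (hs h)
  obtain ⟨c, hc, hcov⟩ := TopologicalSpace.countable_cover_nhds hnhd
  refine hc.mono fun s hs => ?_
  have : s ∈ ⋃ x ∈ c, {s | s ∉ D k ∨ s = x} := hcov ▸ mem_univ s
  obtain ⟨x, hx, hsx⟩ := mem_iUnion₂.1 this
  rcases hsx with h | h
  · exact absurd hs h
  · exact h ▸ hx

/-- A function with one-sided limits everywhere is bounded on compact intervals. -/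
theorem exists_norm_le_of_jumps {f : ℝ → E}
    (hl : ∀ t, ∃ φ, Tendsto f (𝓝[<] t) (𝓝 φ)) (hr : ∀ t, ∃ φ, Tendsto f (𝓝[>] t) (𝓝 φ))
    (a b : ℝ) : ∃ C, ∀ t ∈ Icc a b, ‖f t‖ ≤ C := by
  refine isCompact_Icc.induction_on (p := fun s => ∃ C, ∀ t ∈ s, ‖f t‖ ≤ C)
    ⟨0, by simp⟩ (fun s t hst ⟨C, hC⟩ => ⟨C, fun x hx => hC x (hst hx)⟩) ?_ ?_
  · rintro s t ⟨C, hC⟩ ⟨C', hC'⟩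
    exact ⟨max C C', fun x hx => hx.elim (fun h => (hC x h).trans (le_max_left _ _))
      fun h => (hC' x h).trans (le_max_right _ _)⟩
  · intro t _
    obtain ⟨φ, hφ⟩ := hl t
    obtain ⟨χ, hχ⟩ := hr t
    have h1 := hφ.norm.eventually_le_const (lt_add_one _)
    have h2 := hχ.norm.eventually_le_const (lt_add_one _)
    refine ⟨{s | ‖f s‖ ≤ max (max (‖φ‖ + 1) (‖χ‖ + 1)) ‖f t‖}, mem_nhdsWithin_of_mem_nhds ?_,
      _, fun s hs => hs⟩
    have h3 : ∀ᶠ s in 𝓝[≠] t, ‖f s‖ ≤ max (max (‖φ‖ + 1) (‖χ‖ + 1)) ‖f t‖ := by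
      rw [← Iio_union_Ioi, nhdsWithin_union, eventually_sup]
      exact ⟨h1.mono fun s hs => hs.trans (by simp), h2.mono fun s hs => hs.trans (by simp)⟩
    rw [eventually_nhdsWithin_iff] at h3
    filter_upwards [h3] with s hs
    by_cases h : s = t
    · subst h; exact le_max_right _ _
    · exact hs h

end Jumps

/-! ### Operator families with strong one-sided limits. -/

section Regulated

variable {E : Type} [NormedAddCommGroup E] [InnerProductSpace ℂ E] [CompleteSpace E]

/-- Each orbit `H t ψ` is bounded on compact intervals; the uniform boundedness principle does the
rest. -/
theorem exists_opNorm_le_of_jumps {H : ℝ → E →L[ℂ] E}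
    (hj : ∀ t ψ, (∃ φ, Tendsto (fun τ => H τ ψ) (𝓝[<] t) (𝓝 φ)) ∧
      (∃ φ, Tendsto (fun τ => H τ ψ) (𝓝[>] t) (𝓝 φ))) (a b : ℝ) :
    ∃ C, ∀ t ∈ Icc a b, ‖H t‖ ≤ C := by
  obtain ⟨C, hC⟩ := banach_steinhaus (g := fun t : Icc a b => H t) fun ψ => by
    obtain ⟨C, hC⟩ := exists_norm_le_of_jumps (fun t => (hj t ψ).1) (fun t => (hj t ψ).2) a b
    exact ⟨C, fun t => hC t t.2⟩
  exact ⟨C, fun t ht => hC ⟨t, ht⟩⟩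

/-- A locally bounded family that is strongly continuous at `t` on a total set of vectors is
strongly continuous at `t`. -/
theorem continuousAt_apply_of_hilbertBasis {ι : Type} (b : HilbertBasis ι ℂ E)
    {H : ℝ → E →L[ℂ] E} {t C : ℝ} (hb : ∀ᶠ τ in 𝓝 t, ‖H τ‖ ≤ C)
    (hc : ∀ p, ContinuousAt (fun τ => H τ (b p)) t) (ψ : E) :
    ContinuousAt (fun τ => H τ ψ) t := by
  have hspan : ∀ φ ∈ Submodule.span ℂ (range b), ContinuousAt (fun τ => H τ φ) t := by
    intro φ hφ
    induction hφ using Submodule.span_induction with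
    | mem x hx => obtain ⟨p, rfl⟩ := hx; exact hc p
    | zero => simpa using continuousAt_const
    | add x y _ _ hx hy => simpa only [map_add] using ContinuousAt.fun_add hx hy
    | smul a x _ hx => simpa only [map_smul] using ContinuousAt.fun_const_smul hx a
  have hC : 0 ≤ C := by
    obtain ⟨τ, hτ⟩ := hb.exists
    exact (norm_nonneg _).trans hτ
  refine Metric.tendsto_nhds.2 fun ε hε => ?_
  have hd : ψ ∈ closure (Submodule.span ℂ (range b) : Set E) := by
    rw [← Submodule.topologicalClosure_coe, b.dense_span]; trivial
  -- `C + 1` replaces `C`, which may be zero.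
  obtain ⟨φ, hφ, hlt⟩ := Metric.mem_closure_iff.1 hd (ε / (3 * (C + 1))) (by positivity)
  have h3 := Metric.tendsto_nhds.1 (hspan φ hφ) (ε / 3) (by positivity)
  have hsm : ∀ τ, ‖H τ‖ ≤ C → ‖H τ (ψ - φ)‖ < ε / 3 := by
    intro τ hτ
    rw [dist_eq_norm] at hlt
    have h5 : ‖H τ (ψ - φ)‖ ≤ C * ‖ψ - φ‖ := (H τ).le_of_opNorm_le hτ _
    have h6 : (C + 1) * ‖ψ - φ‖ < ε / 3 := by
      have := (mul_lt_mul_iff_right₀ (show 0 < C + 1 by positivity)).2 hlt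
      calc _ < (C + 1) * (ε / (3 * (C + 1))) := this
        _ = ε / 3 := by field_simp
    nlinarith [norm_nonneg (ψ - φ)]
  filter_upwards [h3, hb] with τ h4 hτ
  rw [dist_eq_norm] at h4 ⊢
  have h7 := hsm τ hτ
  have h8 := hsm t hb.self_of_nhds
  have : H τ ψ - H t ψ = H τ (ψ - φ) + (H τ φ - H t φ) - H t (ψ - φ) := by
    simp only [map_sub]; abel
  rw [this]
  calc _ ≤ ‖H τ (ψ - φ)‖ + ‖H τ φ - H t φ‖ + ‖H t (ψ - φ)‖ :=
        (norm_sub_le _ _).trans (add_le_add_left (norm_add_le _ _) _)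
    _ < ε := by linarith

/-- A family of operators with strong one-sided limits is strongly continuous up to countably many
times. -/
theorem exists_countable_stronglyContinuous {ι : Type} [Countable ι] (b : HilbertBasis ι ℂ E)
    {H : ℝ → E →L[ℂ] E}
    (hj : ∀ t ψ, (∃ φ, Tendsto (fun τ => H τ ψ) (𝓝[<] t) (𝓝 φ)) ∧
      (∃ φ, Tendsto (fun τ => H τ ψ) (𝓝[>] t) (𝓝 φ))) :
    ∃ Z : Set ℝ, Z.Countable ∧ ∀ t ∉ Z, ∀ ψ, ContinuousAt (fun τ => H τ ψ) t := by
  refine ⟨⋃ p, {t | ¬ ContinuousAt (fun τ => H τ (b p)) t}, countable_iUnion fun p =>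
    countable_not_continuousAt_of_jumps (fun t => (hj t _).1) (fun t => (hj t _).2),
    fun t ht ψ => ?_⟩
  simp only [mem_iUnion, mem_ofPred_eq, not_exists, not_not] at ht
  obtain ⟨C, hC⟩ := exists_opNorm_le_of_jumps hj (t - 1) (t + 1)
  exact continuousAt_apply_of_hilbertBasis b
    (mem_of_superset (Icc_mem_nhds (by linarith) (by linarith)) fun τ hτ => hC τ hτ) ht ψ

end Regulated

/-! ### Lipschitz weights and exponential sums on the lattice. -/

section Weights

theorem dist1_nonneg (m n : ℤ × ℤ) : 0 ≤ dist1 m n := by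
  unfold dist1; positivity

theorem dist1_self (m : ℤ × ℤ) : dist1 m m = 0 := by simp [dist1]

theorem dist1_comm (m n : ℤ × ℤ) : dist1 m n = dist1 n m := by
  unfold dist1; rw [abs_sub_comm, abs_sub_comm (m.2 : ℝ)]

theorem dist1_triangle (m k n : ℤ × ℤ) : dist1 m n ≤ dist1 m k + dist1 k n := by
  unfold dist1
  have h1 := abs_sub_le (m.1 : ℝ) k.1 n.1
  have h2 := abs_sub_le (m.2 : ℝ) k.2 n.2
  linarith

/-- Nonnegative functions on `ℤ²` with Lipschitz constant one. -/
structure IsWeight (w : ℤ × ℤ → ℝ) : Prop where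
  nonneg : ∀ m, 0 ≤ w m
  lipschitz : ∀ m n, w m ≤ w n + dist1 m n

theorem isWeight_zero : IsWeight 0 :=
  ⟨fun _ => le_rfl, fun m n => by simpa using dist1_nonneg m n⟩

theorem isWeight_dist1 (n : ℤ × ℤ) : IsWeight (fun m => dist1 m n) :=
  ⟨fun m => dist1_nonneg m n, fun m k => by
    have := dist1_triangle m k n
    linarith⟩

/-- An integer coordinate of `ℤ²`, with Lipschitz constant one. -/
def IsCoord (c : ℤ × ℤ → ℤ) : Prop := ∀ m n, |(c m : ℝ) - c n| ≤ dist1 m n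

theorem isCoord_fst : IsCoord Prod.fst := fun m n => by
  unfold dist1; linarith [abs_nonneg ((m.2 : ℝ) - n.2)]

theorem isCoord_snd : IsCoord Prod.snd := fun m n => by
  unfold dist1; linarith [abs_nonneg ((m.1 : ℝ) - n.1)]

theorem IsCoord.isWeight {c : ℤ × ℤ → ℤ} (hc : IsCoord c) : IsWeight (fun m => |(c m : ℝ)|) :=
  ⟨fun _ => abs_nonneg _, fun m n => by
    have h1 := hc m n
    have h2 := abs_sub_abs_le_abs_sub (c m : ℝ) (c n)
    linarith⟩

theorem summable_exp_abs_int {l : ℝ} (hl : 0 < l) :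
    Summable fun n : ℤ => Real.exp (-l * |(n : ℝ)|) := by
  have h : Summable fun n : ℕ => Real.exp (-l * (n : ℝ)) := by
    have := Real.summable_exp_nat_mul_iff.2 (neg_lt_zero.2 hl)
    exact this.congr fun n => by rw [mul_comm]
  refine Summable.of_nat_of_neg ?_ ?_ <;> simpa using h

theorem summable_exp_dist1 (N : ℕ) {l : ℝ} (hl : 0 < l) (m : ℤ × ℤ) :
    Summable fun p : (ℤ × ℤ) × Fin N => Real.exp (-l * dist1 p.1 m) := by
  have h1 := summable_exp_abs_int hl
  have h2 := h1.mul_of_nonneg h1 (fun _ => (Real.exp_pos _).le) (fun _ => (Real.exp_pos _).le)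
  have h3 : Summable fun k : ℤ × ℤ => Real.exp (-l * dist1 k m) := by
    refine ((Equiv.subRight m).summable_iff.2 h2).congr fun k => ?_
    simp only [Function.comp_apply, Equiv.subRight_apply, Prod.fst_sub, Prod.snd_sub, Int.cast_sub,
      ← Real.exp_add, dist1]
    congr 1; ring
  have h4 : Summable fun _ : Fin N => (1 : ℝ) := summable_of_hasFiniteSupport (Set.toFinite _)
  exact (h3.mul_of_nonneg h4 (fun _ => (Real.exp_pos _).le) (fun _ => zero_le_one)).congr
    fun p => by simp

theorem tsum_exp_dist1 (N : ℕ) (l : ℝ) (m : ℤ × ℤ) :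
    ∑' p : (ℤ × ℤ) × Fin N, Real.exp (-l * dist1 p.1 m) =
      ∑' p : (ℤ × ℤ) × Fin N, Real.exp (-l * dist1 p.1 0) := by
  rw [← ((Equiv.subRight m).prodCongr (Equiv.refl (Fin N))).tsum_eq
    fun p : (ℤ × ℤ) × Fin N => Real.exp (-l * dist1 p.1 0)]
  refine tsum_congr fun p => ?_
  simp [dist1]

end Weights

/-! ### The algebra of exponentially localized operators. -/

section Localized

variable {E : Type} [NormedAddCommGroup E] [InnerProductSpace ℂ E] [CompleteSpace E]
variable {N : ℕ} (b : HilbertBasis ((ℤ × ℤ) × Fin N) ℂ E)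

/-- The families of operators whose matrix elements decay exponentially off the diagonal and along
the diagonal in the weight `w`, uniformly for parameters in `s`. -/
def Localized (s : Set ℝ) (w : ℤ × ℤ → ℝ) (F : ℝ → E →L[ℂ] E) : Prop :=
  ∃ l > 0, ∃ C ≥ 0, ∀ t ∈ s, ∀ p q,
    ‖⟪b p, F t (b q)⟫_ℂ‖ ≤ C * Real.exp (-l * (dist1 p.1 q.1 + w p.1))

variable {b} {s : Set ℝ} {w w' w'' : ℤ × ℤ → ℝ} {F G : ℝ → E →L[ℂ] E}

theorem Localized.mono (hF : Localized b s w F) (h : ∀ m, w' m ≤ w m) : Localized b s w' F := by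
  obtain ⟨l, hl, C, hC, hb⟩ := hF
  refine ⟨l, hl, C, hC, fun t ht p q => (hb t ht p q).trans ?_⟩
  gcongr ?_ * Real.exp ?_
  have := h p.1
  nlinarith

theorem Localized.congr (hF : Localized b s w F) (h : ∀ t ∈ s, G t = F t) : Localized b s w G := by
  obtain ⟨l, hl, C, hC, hb⟩ := hF
  exact ⟨l, hl, C, hC, fun t ht p q => by rw [h t ht]; exact hb t ht p q⟩

theorem Localized.add (hw : IsWeight w) (hF : Localized b s w F) (hG : Localized b s w G) :
    Localized b s w (fun t => F t + G t) := by
  obtain ⟨l, hl, C, hC, hb⟩ := hF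
  obtain ⟨l', hl', C', hC', hb'⟩ := hG
  refine ⟨min l l', lt_min hl hl', C + C', add_nonneg hC hC', fun t ht p q => ?_⟩
  rw [add_apply, inner_add_right, add_mul]
  have h0 := add_nonneg (dist1_nonneg p.1 q.1) (hw.nonneg p.1)
  refine norm_add_le_of_le ((hb t ht p q).trans ?_) ((hb' t ht p q).trans ?_)
  · gcongr
    exact min_le_left _ _
  · gcongr
    exact min_le_right _ _

theorem Localized.const_smul (hF : Localized b s w F) (c : ℂ) :
    Localized b s w (fun t => c • F t) := by
  obtain ⟨l, hl, C, hC, hb⟩ := hF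
  refine ⟨l, hl, ‖c‖ * C, by positivity, fun t ht p q => ?_⟩
  rw [smul_apply, inner_smul_right, norm_mul, mul_assoc]
  gcongr
  exact hb t ht p q

theorem Localized.sub (hw : IsWeight w) (hF : Localized b s w F) (hG : Localized b s w G) :
    Localized b s w (fun t => F t - G t) :=
  (hF.add hw (hG.const_smul (-1))).congr fun t _ => by rw [neg_one_smul, sub_eq_add_neg]

theorem Localized.star (hF : Localized b s 0 F) : Localized b s 0 (fun t => star (F t)) := by
  obtain ⟨l, hl, C, hC, hb⟩ := hF
  refine ⟨l, hl, C, hC, fun t ht p q => ?_⟩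
  change ‖⟪b p, (Star.star (F t)) (b q)⟫_ℂ‖ ≤ _
  rw [ContinuousLinearMap.star_eq_adjoint, ContinuousLinearMap.adjoint_inner_right,
    norm_inner_symm, dist1_comm]
  exact hb t ht q p

theorem inner_mul_eq_tsum (K L : E →L[ℂ] E) (p q : (ℤ × ℤ) × Fin N) :
    HasSum (fun r => ⟪b p, K (b r)⟫_ℂ * ⟪b r, L (b q)⟫_ℂ) ⟪b p, (K * L) (b q)⟫_ℂ := by
  have h := b.hasSum_inner_mul_inner (ContinuousLinearMap.adjoint K (b p)) (L (b q))
  simpa only [ContinuousLinearMap.adjoint_inner_left, mul_apply_eq_comp] using h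

/-- Weights add under products: the Lipschitz property moves `w'` from the intermediate site `r` to
the row `p` at the cost of `dist1 p r`, which the off-diagonal decay of `F` pays for. -/
theorem Localized.mul (hF : Localized b s w F) (hG : Localized b s w' G) (hw : IsWeight w)
    (hw' : IsWeight w') (h : ∀ m, w'' m ≤ w m + w' m) :
    Localized b s w'' (fun t => F t * G t) := by
  obtain ⟨l, hl, C, hC, hb⟩ := hF
  obtain ⟨l', hl', C', hC', hb'⟩ := hG
  -- The triangle inequality, the shift of the weight and the factor kept for summing over `r` use
  -- each distance at most twice; a quarter of the rate leaves room.
  set k := min l l' / 4 with hk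
  have hk0 : 0 < k := by have := lt_min hl hl'; positivity
  have hkl : 4 * k ≤ l := by rw [hk]; linarith [min_le_left l l']
  have hkl' : 4 * k ≤ l' := by rw [hk]; linarith [min_le_right l l']
  refine ⟨k, hk0, C * C' * ∑' p : (ℤ × ℤ) × Fin N, Real.exp (-k * dist1 p.1 0), by positivity,
    fun t ht p q => ?_⟩
  have hs : HasSum (fun r : (ℤ × ℤ) × Fin N =>
      C * C' * Real.exp (-k * (dist1 p.1 q.1 + w'' p.1)) * Real.exp (-k * dist1 r.1 q.1))
      (C * C' * Real.exp (-k * (dist1 p.1 q.1 + w'' p.1)) *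
        ∑' p : (ℤ × ℤ) × Fin N, Real.exp (-k * dist1 p.1 0)) := by
    rw [← tsum_exp_dist1 N k q.1]
    exact (summable_exp_dist1 N hk0 q.1).hasSum.mul_left _
  rw [mul_right_comm]
  refine (inner_mul_eq_tsum (F t) (G t) p q).norm_le_of_bounded hs fun r => ?_
  rw [norm_mul]
  refine (mul_le_mul (hb t ht p r) (hb' t ht r q) (norm_nonneg _) (by positivity)).trans ?_
  rw [mul_mul_mul_comm, ← Real.exp_add, mul_assoc (C * C'), ← Real.exp_add]
  refine mul_le_mul_of_nonneg_left (Real.exp_le_exp.2 ?_) (by positivity)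
  have h1 := dist1_triangle p.1 r.1 q.1
  have h2 := h p.1
  have h3 := hw'.lipschitz p.1 r.1
  have h4 := hw.nonneg p.1
  have h5 := hw'.nonneg r.1
  have h6 := dist1_nonneg p.1 r.1
  have h7 := dist1_nonneg r.1 q.1
  have h8 : 4 * k * (dist1 p.1 r.1 + w p.1) ≤ l * (dist1 p.1 r.1 + w p.1) :=
    mul_le_mul_of_nonneg_right hkl (by positivity)
  have h9 : 4 * k * (dist1 r.1 q.1 + w' r.1) ≤ l' * (dist1 r.1 q.1 + w' r.1) :=
    mul_le_mul_of_nonneg_right hkl' (by positivity)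
  have h10 : k * (dist1 p.1 q.1 + w'' p.1 + dist1 r.1 q.1) ≤
      k * (4 * (dist1 p.1 r.1 + w p.1) + 4 * (dist1 r.1 q.1 + w' r.1)) :=
    mul_le_mul_of_nonneg_left (by linarith) hk0.le
  linarith

theorem Localized.mul_zero (hF : Localized b s w F) (hG : Localized b s 0 G) (hw : IsWeight w) :
    Localized b s w (fun t => F t * G t) :=
  hF.mul hG hw isWeight_zero fun m => by simp

theorem Localized.zero_mul (hF : Localized b s 0 F) (hG : Localized b s w G) (hw : IsWeight w) :
    Localized b s w (fun t => F t * G t) :=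
  hF.mul hG isWeight_zero hw fun m => by simp

end Localized

/-! ### Multiplication operators and switch functions. -/

section Diagonal

variable {E : Type} [NormedAddCommGroup E] [InnerProductSpace ℂ E] [CompleteSpace E]
variable {N : ℕ} (b : HilbertBasis ((ℤ × ℤ) × Fin N) ℂ E)

/-- `L` is multiplication by the real function `f`, in the basis `b`. -/
def IsDiagonal (f : ℤ × ℤ → ℝ) (L : E →L[ℂ] E) : Prop := ∀ p, L (b p) = (f p.1 : ℂ) • b p

variable {b} {f g : ℤ × ℤ → ℝ} {L M : E →L[ℂ] E} {s : Set ℝ}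

theorem clm_ext_basis {ι : Type} {b : HilbertBasis ι ℂ E} {K K' : E →L[ℂ] E}
    (h : ∀ p, K (b p) = K' (b p)) : K = K' := by
  refine ContinuousLinearMap.ext_on (s := range b) ?_ ?_
  · rw [dense_iff_closure_eq, ← Submodule.topologicalClosure_coe, b.dense_span]; rfl
  · rintro _ ⟨p, rfl⟩; exact h p

theorem inner_basis (p q : (ℤ × ℤ) × Fin N) : ⟪b p, b q⟫_ℂ = if p = q then 1 else 0 :=
  orthonormal_iff_ite.1 b.orthonormal p q

theorem IsDiagonal.inner_right (hL : IsDiagonal b f L) (p q : (ℤ × ℤ) × Fin N) (K : E →L[ℂ] E) :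
    ⟪b p, (K * L) (b q)⟫_ℂ = f q.1 * ⟪b p, K (b q)⟫_ℂ := by
  rw [mul_apply_eq_comp, hL, map_smul, inner_smul_right]

theorem IsDiagonal.isSelfAdjoint (hL : IsDiagonal b f L) : star L = L := by
  refine clm_ext_basis (b := b) fun p => ?_
  refine b.repr.injective ?_
  ext q
  rw [b.repr_apply_apply, b.repr_apply_apply, ContinuousLinearMap.star_eq_adjoint,
    ContinuousLinearMap.adjoint_inner_right, hL, hL, inner_smul_left, inner_smul_right, inner_basis]
  by_cases h : q = p
  · simp [h]
  · simp [h]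

theorem IsDiagonal.inner_left (hL : IsDiagonal b f L) (p q : (ℤ × ℤ) × Fin N) (K : E →L[ℂ] E) :
    ⟪b p, (L * K) (b q)⟫_ℂ = f p.1 * ⟪b p, K (b q)⟫_ℂ := by
  rw [mul_apply_eq_comp, ← hL.isSelfAdjoint, ContinuousLinearMap.star_eq_adjoint,
    ContinuousLinearMap.adjoint_inner_right, hL, inner_smul_left, Complex.conj_ofReal]

theorem IsDiagonal.commute (hL : IsDiagonal b f L) (hM : IsDiagonal b g M) : L * M = M * L :=
  clm_ext_basis (b := b) fun p => by
    rw [mul_apply_eq_comp, mul_apply_eq_comp, hL, hM, map_smul, map_smul, hL, hM, smul_comm]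

theorem IsDiagonal.sub (hL : IsDiagonal b f L) (hM : IsDiagonal b g M) :
    IsDiagonal b (fun m => f m - g m) (L - M) := fun p => by
  rw [sub_apply, hL, hM, ← sub_smul]; push_cast; rfl

theorem IsDiagonal.localized (hL : IsDiagonal b f L) {c : ℤ × ℤ → ℤ} {R C : ℝ} (hC : 0 ≤ C)
    (hb : ∀ m, |f m| ≤ C) (hR : ∀ m, R < |(c m : ℝ)| → f m = 0) :
    Localized b s (fun m => |(c m : ℝ)|) (fun _ => L) := by
  -- On the support of `f` the weight is at most `R`, so `Real.exp R` compensates its decay.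
  refine ⟨1, one_pos, C * Real.exp R, by positivity, fun t _ p q => ?_⟩
  rw [hL, inner_smul_right, inner_basis, mul_assoc, ← Real.exp_add]
  split_ifs with h
  · subst h
    rw [mul_one, Complex.norm_real, Real.norm_eq_abs, dist1_self]
    rcases lt_or_ge R |(c p.1 : ℝ)| with h | h
    · rw [hR _ h, abs_zero]; positivity
    · refine (hb p.1).trans (le_mul_of_one_le_right hC (Real.one_le_exp ?_))
      linarith
  · rw [MulZeroClass.mul_zero, norm_zero]; positivity

theorem IsDiagonal.localized_zero (hL : IsDiagonal b f L) {C : ℝ} (hC : 0 ≤ C)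
    (hb : ∀ m, |f m| ≤ C) : Localized b s 0 (fun _ => L) := by
  have := hL.localized (s := s) (c := fun _ => 0) (R := 0) hC hb (by simp)
  exact this.mono (by simp)

theorem SwitchFunction.exists_radius (Λ : SwitchFunction) :
    ∃ R : ℝ, 0 ≤ R ∧ (∀ n : ℤ, R < n → Λ.toFun n = 1) ∧ ∀ n : ℤ, (n : ℝ) < -R → Λ.toFun n = 0 := by
  obtain ⟨a, ha⟩ := eventually_atTop.1 Λ.eventually_one
  obtain ⟨c, hc⟩ := eventually_atBot.1 Λ.eventually_zero
  refine ⟨max |(a : ℝ)| |(c : ℝ)|, by positivity, fun n hn => ha n ?_, fun n hn => hc n ?_⟩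
  · have h1 := le_max_left |(a : ℝ)| |(c : ℝ)|
    have h2 := le_abs_self (a : ℝ)
    exact_mod_cast (show (a : ℝ) ≤ n by linarith)
  · have h1 := le_max_right |(a : ℝ)| |(c : ℝ)|
    have h2 := neg_abs_le (c : ℝ)
    exact_mod_cast (show (n : ℝ) ≤ c by linarith)

variable (b) in
/-- `L` is multiplication by the switch function `Λ` in the coordinate `c`. -/
def IsSwitch (c : ℤ × ℤ → ℤ) (Λ : SwitchFunction) (L : E →L[ℂ] E) : Prop :=
  IsDiagonal b (fun m => Λ.toFun (c m)) L

variable {c : ℤ × ℤ → ℤ} {Λ Λ' : SwitchFunction} {F : ℝ → E →L[ℂ] E}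

theorem IsSwitch.localized (hL : IsSwitch b c Λ L) : Localized b s 0 (fun _ => L) := by
  obtain ⟨C, hC, hb⟩ := Λ.bounded
  exact IsDiagonal.localized_zero (f := fun m => Λ.toFun (c m)) hL hC fun m => hb _

theorem IsSwitch.localized_sub (hL : IsSwitch b c Λ L) (hM : IsSwitch b c Λ' M) :
    Localized b s (fun m => |(c m : ℝ)|) (fun _ => L - M) := by
  obtain ⟨C, hC, hb⟩ := Λ.bounded
  obtain ⟨C', hC', hb'⟩ := Λ'.bounded
  obtain ⟨R, hR, h1, h0⟩ := Λ.exists_radius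
  obtain ⟨R', hR', h1', h0'⟩ := Λ'.exists_radius
  refine (IsDiagonal.sub hL hM).localized (R := max R R') (add_nonneg hC hC')
    (fun m => (abs_sub _ _).trans (add_le_add (hb _) (hb' _))) fun m hm => ?_
  have hl := le_max_left R R'
  have hr := le_max_right R R'
  rcases lt_abs.1 hm with h | h
  · rw [h1 _ (by linarith), h1' _ (by linarith), sub_self]
  · rw [h0 _ (by linarith), h0' _ (by linarith), sub_self]

/-- The commutator of a local operator with a switch function is confined to the region where the
switch function varies. -/
theorem IsSwitch.localized_commutator (hL : IsSwitch b c Λ L) (hc : IsCoord c)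
    (hF : Localized b s 0 F) :
    Localized b s (fun m => |(c m : ℝ)|) (fun t => L * F t - F t * L) := by
  obtain ⟨C, hC, hb⟩ := Λ.bounded
  obtain ⟨R, hR, h1, h0⟩ := Λ.exists_radius
  obtain ⟨l, hl, K, hK, hbd⟩ := hF
  -- If `Λ` differs at `p` and `q`, the segment between them meets the strip of radius `R`, so `|c
  -- p| ≤ R + dist1 p q`. Half of the off-diagonal decay is traded for decay in `|c p|`, at the
  -- price of `Real.exp (l / 2 * R)`.
  refine ⟨l / 2, half_pos hl, (C + C) * (K * Real.exp (l / 2 * R)), by positivity,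
    fun t ht p q => ?_⟩
  rw [sub_apply, inner_sub_right, IsDiagonal.inner_left hL, IsDiagonal.inner_right hL, ← sub_mul,
    norm_mul, ← Complex.ofReal_sub, Complex.norm_real, Real.norm_eq_abs, mul_assoc, mul_assoc]
  have hd := hc p.1 q.1
  have hkey : Λ.toFun (c p.1) - Λ.toFun (c q.1) = 0 ∨ |(c p.1 : ℝ)| ≤ R + dist1 p.1 q.1 := by
    by_contra! hcon
    obtain ⟨hne, hgt⟩ := hcon
    have hd' := abs_le.1 hd
    rcases lt_abs.1 hgt with h | h
    · exact hne (by rw [h1 _ (by linarith [dist1_nonneg p.1 q.1]), h1 _ (by linarith), sub_self])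
    · exact hne (by rw [h0 _ (by linarith [dist1_nonneg p.1 q.1]), h0 _ (by linarith), sub_self])
  rcases hkey with h | h
  · rw [h, abs_zero, MulZeroClass.zero_mul]; positivity
  · refine mul_le_mul ((abs_sub _ _).trans (add_le_add (hb _) (hb _))) ((hbd t ht p q).trans ?_)
      (norm_nonneg _) (by positivity)
    rw [← Real.exp_add]
    gcongr
    simp only [Pi.zero_apply, add_zero]
    nlinarith

end Diagonal

/-! ### Unitary evolutions and the fundamental theorem of calculus. -/

section Evolution

variable {E : Type} [NormedAddCommGroup E] [InnerProductSpace ℂ E] [CompleteSpace E]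
variable {Z : Set ℝ} {T : ℝ} {F F' G H U : ℝ → E →L[ℂ] E}

/-- Uniformly bounded, strongly continuous families of operators. -/
structure StronglyContinuous (F : ℝ → E →L[ℂ] E) : Prop where
  bound : ∃ C, ∀ t, ‖F t‖ ≤ C
  cont : ∀ ψ, Continuous fun t => F t ψ

theorem StronglyContinuous.stronglyRegular (hF : StronglyContinuous F) : StronglyRegular Z T F :=
  ⟨hF.bound.imp fun _ h t _ => h t, fun _ _ ψ => (hF.cont ψ).continuousAt⟩

theorem stronglyContinuous_const (K : E →L[ℂ] E) : StronglyContinuous fun _ => K :=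
  ⟨⟨‖K‖, fun _ => le_rfl⟩, fun _ => continuous_const⟩

theorem StronglyContinuous.mul (hF : StronglyContinuous F) (hG : StronglyContinuous G) :
    StronglyContinuous fun t => F t * G t := by
  obtain ⟨C, hC⟩ := hF.bound
  obtain ⟨C', hC'⟩ := hG.bound
  refine ⟨⟨C * C', fun t => (norm_mul_le _ _).trans
      (mul_le_mul (hC t) (hC' t) (norm_nonneg _) ((norm_nonneg _).trans (hC t)))⟩,
    fun ψ => continuous_iff_continuousAt.2 fun t => ?_⟩
  exact tendsto_clm_apply (F := F) (F₀ := F t) (v₀ := G t ψ) (Eventually.of_forall hC)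
    (fun φ => (hF.cont φ).tendsto t) ((hG.cont ψ).tendsto t)

theorem StronglyContinuous.sub (hF : StronglyContinuous F) (hG : StronglyContinuous G) :
    StronglyContinuous fun t => F t - G t := by
  obtain ⟨C, hC⟩ := hF.bound
  obtain ⟨C', hC'⟩ := hG.bound
  exact ⟨⟨C + C', fun t => norm_sub_le_of_le (hC t) (hC' t)⟩,
    fun ψ => (hF.cont ψ).sub (hG.cont ψ)⟩

theorem StronglyRegular.intervalIntegrable_inner (hF : StronglyRegular Z T F) (hZ : Z.Countable)
    {t : ℝ} (ht : t ∈ Icc 0 T) (φ ψ : E) :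
    IntervalIntegrable (fun τ => ⟪φ, F τ ψ⟫_ℂ) volume 0 t := by
  obtain ⟨C, hC⟩ := hF.bound
  rw [intervalIntegrable_iff_integrableOn_Ioo_of_le ht.1]
  have hI : IntegrableOn (fun τ => ⟪φ, F τ ψ⟫_ℂ) (Ioo 0 T) := by
    refine Integrable.of_bound (hF.aestronglyMeasurable_inner hZ φ ψ) (‖φ‖ * (C * ‖ψ‖)) ?_
    refine (ae_restrict_iff' measurableSet_Ioo).2 (Eventually.of_forall fun τ hτ => ?_)
    refine (norm_inner_le_norm _ _).trans ?_
    gcongr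
    exact (F τ).le_of_opNorm_le (hC τ (Ioo_subset_Icc_self hτ)) ψ
  exact hI.mono_set (Ioo_subset_Ioo_right ht.2)

/-- The fundamental theorem of calculus for matrix elements of strongly differentiable families. -/
theorem integral_inner_strongDeriv (hZ : Z.Countable) (hF : StronglyContinuous F)
    (hd : ∀ t ∈ Ioo 0 T \ Z, HasStrongDerivAt F (F' t) t) (hF' : StronglyRegular Z T F')
    {t : ℝ} (ht : t ∈ Icc 0 T) (φ ψ : E) :
    ∫ τ in (0 : ℝ)..t, ⟪φ, F' τ ψ⟫_ℂ = ⟪φ, F t ψ⟫_ℂ - ⟪φ, F 0 ψ⟫_ℂ := by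
  refine integral_eq_of_hasDerivAt_off_countable_of_le (fun τ => ⟪φ, F τ ψ⟫_ℂ) _ ht.1 hZ
    (continuous_const.inner (𝕜 := ℂ) (hF.cont ψ)).continuousOn (fun τ hτ => ?_)
    (hF'.intervalIntegrable_inner hZ ht φ ψ)
  have h1 := hd τ ⟨⟨hτ.1.1, hτ.1.2.trans_le ht.2⟩, hτ.2⟩ ψ
  simpa using (hasDerivAt_const τ φ).inner ℂ h1

/-- `U` is a family of unitaries that solves `i ∂ₜ U = H U` on `(0,T)` away from the exceptional
times `Z`, with initial value one. -/
structure IsEvolution (Z : Set ℝ) (T : ℝ) (H U : ℝ → E →L[ℂ] E) : Prop where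
  unitary : ∀ t, U t ∈ _root_.unitary (E →L[ℂ] E)
  zero : U 0 = 1
  cont : ∀ ψ, Continuous fun t => U t ψ
  cont_star : ∀ ψ, Continuous fun t => star (U t) ψ
  deriv : ∀ t ∈ Ioo 0 T \ Z, HasStrongDerivAt U ((-Complex.I) • (H t * U t)) t

theorem IsEvolution.stronglyContinuous (hU : IsEvolution Z T H U) : StronglyContinuous U :=
  ⟨⟨1, fun t => norm_le_one_of_mem_unitary (hU.unitary t)⟩, hU.cont⟩

theorem IsEvolution.stronglyContinuous_star (hU : IsEvolution Z T H U) :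
    StronglyContinuous fun t => star (U t) :=
  ⟨⟨1, fun t => norm_le_one_of_mem_unitary (Unitary.star_mem (hU.unitary t))⟩, hU.cont_star⟩

theorem IsEvolution.star_mul (hU : IsEvolution Z T H U) (t : ℝ) : star (U t) * U t = 1 :=
  (Unitary.mem_iff.1 (hU.unitary t)).1

theorem IsEvolution.mul_star (hU : IsEvolution Z T H U) (t : ℝ) : U t * star (U t) = 1 :=
  (Unitary.mem_iff.1 (hU.unitary t)).2

theorem IsEvolution.deriv_star (hU : IsEvolution Z T H U) {t : ℝ} (ht : t ∈ Ioo 0 T \ Z) :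
    HasStrongDerivAt (fun τ => star (U τ)) (Complex.I • (star (U t) * H t)) t := by
  have h := (hU.deriv t ht).star_of_unitary hU.unitary hU.cont_star
  rw [mul_smul_comm, smul_mul_assoc, ← smul_neg, smul_neg, ← neg_smul, neg_neg, mul_assoc,
    mul_assoc, hU.mul_star, mul_one] at h
  exact h

end Evolution

/-! ### Locality of the evolution. -/

section Propagation

variable {E : Type} [NormedAddCommGroup E] [InnerProductSpace ℂ E] [CompleteSpace E]
variable {N : ℕ} {b : HilbertBasis ((ℤ × ℤ) × Fin N) ℂ E}
variable {Z : Set ℝ} {T : ℝ} {H U : ℝ → E →L[ℂ] E}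

/-- A local Hamiltonian generates a local evolution. -/
theorem IsEvolution.localized (hZ : Z.Countable) (hU : IsEvolution Z T H U)
    (hH : StronglyRegular Z T H) (hloc : Localized b (Icc 0 T) 0 H) :
    Localized b (Icc 0 T) 0 U := by
  obtain ⟨l, hl, C, hC, hb⟩ := hloc
  -- One half of the decay of `H` is combined with the decay of `U` by the triangle inequality, the
  -- other half makes the sum over intermediate sites converge.
  set k := l / 2 with hk
  have hk0 : 0 < k := half_pos hl
  set S := ∑' p : (ℤ × ℤ) × Fin N, Real.exp (-k * dist1 p.1 0) with hS
  have hS0 : 0 ≤ S := tsum_nonneg fun _ => (Real.exp_pos _).le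
  set K := C * S with hK
  have hK0 : 0 ≤ K := mul_nonneg hC hS0
  have hHb : ∀ t ∈ Icc 0 T, ∀ p r, ‖⟪b p, H t (b r)⟫_ℂ‖ ≤
      C * (Real.exp (-k * dist1 p.1 r.1) * Real.exp (-k * dist1 r.1 p.1)) := by
    intro t ht p r
    refine (hb t ht p r).trans_eq ?_
    rw [← Real.exp_add, dist1_comm r.1 p.1, hk, Pi.zero_apply, add_zero]
    congr 2; ring
  have hsum : ∀ p : (ℤ × ℤ) × Fin N,
      HasSum (fun r : (ℤ × ℤ) × Fin N => Real.exp (-k * dist1 r.1 p.1)) S := fun p => by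
    rw [hS, ← tsum_exp_dist1 N k p.1]
    exact (summable_exp_dist1 N hk0 p.1).hasSum
  -- Iteration of the integral equation. The first summand reproduces itself under the iteration.
  -- The second starts from the trivial bound `1 ≤ exp (2 K t)` and is halved at each round, because
  -- integrating `K exp (2 K τ)` gains a factor `1 / 2`.
  have main : ∀ (q : (ℤ × ℤ) × Fin N) (n : ℕ), ∀ t ∈ Icc 0 T, ∀ p, ‖⟪b p, U t (b q)⟫_ℂ‖ ≤
      Real.exp (-k * dist1 p.1 q.1) * Real.exp (K * t) + (1 / 2) ^ n * Real.exp (2 * K * t) := by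
    intro q n
    induction n with
    | zero =>
      intro t ht p
      have h1 : ‖⟪b p, U t (b q)⟫_ℂ‖ ≤ 1 := by
        refine (norm_inner_le_norm _ _).trans ?_
        rw [b.orthonormal.1 p, one_mul]
        have := (U t).le_of_opNorm_le (norm_le_one_of_mem_unitary (hU.unitary t)) (b q)
        rwa [b.orthonormal.1 q, one_mul] at this
      have h2 : 1 ≤ Real.exp (2 * K * t) := Real.one_le_exp (by have := ht.1; positivity)
      have h3 := Real.exp_pos (-k * dist1 p.1 q.1)
      have h4 := Real.exp_pos (K * t)
      rw [pow_zero, one_mul]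
      nlinarith
    | succ n ih =>
      intro t ht p
      set d := Real.exp (-k * dist1 p.1 q.1) with hd
      have hint := integral_inner_strongDeriv hZ hU.stronglyContinuous hU.deriv
        ((hH.mul hU.stronglyContinuous.stronglyRegular).const_smul (-Complex.I)) ht (b p) (b q)
      have hpt : ∀ τ ∈ Icc 0 T, ‖⟪b p, ((-Complex.I) • (H τ * U τ)) (b q)⟫_ℂ‖ ≤
          d * (K * Real.exp (K * τ)) + (1 / 2) ^ (n + 1) * (2 * K * Real.exp (2 * K * τ)) := by
        intro τ hτ
        rw [smul_apply, inner_smul_right, norm_mul, norm_neg, Complex.norm_I, one_mul]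
        have hbs := (hsum p).mul_left
          (C * (d * Real.exp (K * τ) + (1 / 2) ^ n * Real.exp (2 * K * τ)))
        refine ((inner_mul_eq_tsum (H τ) (U τ) p q).norm_le_of_bounded hbs fun r => ?_).trans_eq ?_
        · rw [norm_mul]
          refine (mul_le_mul (hHb τ hτ p r) (ih τ hτ r) (norm_nonneg _) (by positivity)).trans ?_
          rw [mul_add]
          have e1 : Real.exp (-k * dist1 p.1 r.1) * Real.exp (-k * dist1 r.1 q.1) ≤ d := by
            rw [← Real.exp_add, hd]
            refine Real.exp_le_exp.2 ?_
            have := dist1_triangle p.1 r.1 q.1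
            nlinarith
          have e2 : Real.exp (-k * dist1 p.1 r.1) ≤ 1 := Real.exp_le_one_iff.2 (by
            have := dist1_nonneg p.1 r.1
            nlinarith)
          set x := Real.exp (-k * dist1 p.1 r.1)
          set y := Real.exp (-k * dist1 r.1 q.1)
          have hy : 0 ≤ Real.exp (-k * dist1 r.1 p.1) := (Real.exp_pos _).le
          calc _ = C * Real.exp (-k * dist1 r.1 p.1) * ((x * y) * Real.exp (K * τ) +
                x * ((1 / 2) ^ n * Real.exp (2 * K * τ))) := by ring
            _ ≤ C * Real.exp (-k * dist1 r.1 p.1) * (d * Real.exp (K * τ) +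
                1 * ((1 / 2) ^ n * Real.exp (2 * K * τ))) := by gcongr
            _ = _ := by ring
        · rw [hK, pow_succ]; ring
      have hder : ∀ τ, HasDerivAt (fun τ => d * Real.exp (K * τ) +
          (1 / 2) ^ (n + 1) * Real.exp (2 * K * τ)) (d * (K * Real.exp (K * τ)) +
          (1 / 2) ^ (n + 1) * (2 * K * Real.exp (2 * K * τ))) τ := by
        intro τ
        have h1 := ((hasDerivAt_id τ).const_mul K).exp
        have h2 := ((hasDerivAt_id τ).const_mul (2 * K)).exp
        refine ((h1.const_mul d).add (h2.const_mul ((1 / 2) ^ (n + 1)))).congr_deriv ?_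
        simp only [id]; ring
      have hcont : Continuous fun τ => d * (K * Real.exp (K * τ)) +
          (1 / 2) ^ (n + 1) * (2 * K * Real.exp (2 * K * τ)) := by fun_prop
      have hI := intervalIntegral.integral_eq_sub_of_hasDerivAt (a := 0) (b := t)
        (fun τ _ => hder τ) (hcont.intervalIntegrable _ _)
      have hle : ‖∫ τ in (0 : ℝ)..t, ⟪b p, ((-Complex.I) • (H τ * U τ)) (b q)⟫_ℂ‖ ≤ _ :=
        intervalIntegral.norm_integral_le_of_norm_le ht.1
          (Eventually.of_forall fun τ hτ => hpt τ ⟨hτ.1.le, hτ.2.trans ht.2⟩)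
          (hcont.intervalIntegrable _ _)
      rw [hI, hint, hU.zero] at hle
      have h0 : ‖⟪b p, (1 : E →L[ℂ] E) (b q)⟫_ℂ‖ ≤ d := by
        rw [one_apply_eq_self, inner_basis]
        split_ifs with h
        · rw [hd, h, dist1_self]; simp
        · rw [norm_zero]; positivity
      have h1 := norm_le_norm_add_norm_sub' ⟪b p, U t (b q)⟫_ℂ ⟪b p, (1 : E →L[ℂ] E) (b q)⟫_ℂ
      simp only [MulZeroClass.mul_zero, Real.exp_zero, mul_one] at hle
      have h2 : (0 : ℝ) ≤ (1 / 2) ^ (n + 1) := by positivity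
      linarith
  refine ⟨k, hk0, Real.exp (K * T), by positivity, fun t ht p q => ?_⟩
  have hlim : Tendsto (fun n : ℕ => Real.exp (-k * dist1 p.1 q.1) * Real.exp (K * t) +
      (1 / 2) ^ n * Real.exp (2 * K * t)) atTop
      (𝓝 (Real.exp (-k * dist1 p.1 q.1) * Real.exp (K * t) + 0 * Real.exp (2 * K * t))) :=
    tendsto_const_nhds.add ((tendsto_pow_atTop_nhds_zero_of_lt_one (by norm_num)
      (by norm_num)).mul_const _)
  refine (ge_of_tendsto' hlim fun n => main q n t ht p).trans ?_
  rw [MulZeroClass.zero_mul, add_zero, mul_comm, Pi.zero_apply, add_zero]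
  have := ht.2
  gcongr

end Propagation

/-! ### Traces of confined operators. -/

section Trace

variable {E : Type} [NormedAddCommGroup E] [InnerProductSpace ℂ E] [CompleteSpace E]
variable {N : ℕ} (b : HilbertBasis ((ℤ × ℤ) × Fin N) ℂ E)

/-- The trace in the basis `b`. -/
noncomputable def opTrace (K : E →L[ℂ] E) : ℂ := ∑' p, ⟪b p, K (b p)⟫_ℂ

/-- The diagonal matrix elements of `K` are absolutely summable. -/
def DiagSummable (K : E →L[ℂ] E) : Prop := Summable fun p => ⟪b p, K (b p)⟫_ℂ

/-- The families that are localized near the origin, in particular trace class. -/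
abbrev Confined (T : ℝ) (F : ℝ → E →L[ℂ] E) : Prop :=
  Localized b (Icc 0 T) (fun m => dist1 m 0) F

variable {b} {s : Set ℝ} {w w' : ℤ × ℤ → ℝ} {F F' G : ℝ → E →L[ℂ] E} {K L M U : E →L[ℂ] E}
variable {Z : Set ℝ} {T t : ℝ}

theorem Confined.exists_bound (hF : Confined b T F) :
    ∃ g : (ℤ × ℤ) × Fin N → ℝ, Summable g ∧ ∀ t ∈ Icc 0 T, ∀ p, ‖⟪b p, F t (b p)⟫_ℂ‖ ≤ g p := by
  obtain ⟨l, hl, C, hC, hb⟩ := hF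
  refine ⟨fun p => C * Real.exp (-l * dist1 p.1 0), (summable_exp_dist1 N hl 0).mul_left C,
    fun t ht p => (hb t ht p p).trans_eq ?_⟩
  rw [dist1_self, zero_add]

theorem Confined.diagSummable (hF : Confined b T F) (ht : t ∈ Icc 0 T) :
    DiagSummable b (F t) := by
  obtain ⟨g, hg, h⟩ := hF.exists_bound
  exact hg.of_norm_bounded (h t ht)

theorem opTrace_add (hK : DiagSummable b K) (hL : DiagSummable b L) :
    opTrace b (K + L) = opTrace b K + opTrace b L := by
  unfold opTrace
  rw [← hK.tsum_add hL]
  exact tsum_congr fun p => by rw [add_apply, inner_add_right]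

theorem opTrace_sub (hK : DiagSummable b K) (hL : DiagSummable b L) :
    opTrace b (K - L) = opTrace b K - opTrace b L := by
  unfold opTrace
  rw [← hK.tsum_sub hL]
  exact tsum_congr fun p => by rw [sub_apply, inner_sub_right]

theorem opTrace_smul (c : ℂ) (K : E →L[ℂ] E) : opTrace b (c • K) = c * opTrace b K := by
  unfold opTrace
  rw [← tsum_mul_left]
  exact tsum_congr fun p => by rw [smul_apply, inner_smul_right]

/-- The diagonal matrix elements agree one by one, so no summability is needed. -/
theorem IsDiagonal.opTrace_comm {f : ℤ × ℤ → ℝ} (hL : IsDiagonal b f L) (K : E →L[ℂ] E) :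
    opTrace b (K * L) = opTrace b (L * K) :=
  tsum_congr fun p => by rw [hL.inner_left, hL.inner_right]

/-- Cyclicity of the trace. -/
theorem Localized.opTrace_comm (hF : Localized b s w F) (hG : Localized b s w' G)
    (hw : IsWeight w) (hw' : IsWeight w') (h : ∀ m, dist1 m 0 ≤ w m + w' m) (ht : t ∈ s) :
    opTrace b (F t * G t) = opTrace b (G t * F t) := by
  obtain ⟨l, hl, C, hC, hb⟩ := hF
  obtain ⟨l', hl', C', hC', hb'⟩ := hG
  set k := min l l' with hk
  have hk0 : 0 < k := lt_min hl hl'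
  -- The weight `w'` is moved from `q` to `p`, paid for by the decay of `F t`. This bound is
  -- summable in the pair `(p, q)`, so the two sums may be exchanged although neither factor need be
  -- confined.
  have hbd : ∀ p q, ‖⟪b p, F t (b q)⟫_ℂ * ⟪b q, G t (b p)⟫_ℂ‖ ≤
      C * C' * Real.exp (-k * dist1 p.1 0) * Real.exp (-k * dist1 q.1 p.1) := by
    intro p q
    rw [norm_mul]
    refine (mul_le_mul (hb t ht p q) (hb' t ht q p) (norm_nonneg _) (by positivity)).trans ?_
    rw [mul_mul_mul_comm, ← Real.exp_add, mul_assoc (C * C'), ← Real.exp_add]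
    refine mul_le_mul_of_nonneg_left (Real.exp_le_exp.2 ?_) (by positivity)
    have h1 := dist1_comm p.1 q.1
    have h2 := h p.1
    have h3 := hw'.lipschitz p.1 q.1
    have h4 := hw.nonneg p.1
    have h5 := hw'.nonneg q.1
    have h6 := dist1_nonneg p.1 q.1
    have h7 := dist1_nonneg q.1 p.1
    have h8 : k * (dist1 p.1 q.1 + w p.1) ≤ l * (dist1 p.1 q.1 + w p.1) :=
      mul_le_mul_of_nonneg_right (min_le_left _ _) (by positivity)
    have h9 : k * (dist1 q.1 p.1 + w' q.1) ≤ l' * (dist1 q.1 p.1 + w' q.1) :=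
      mul_le_mul_of_nonneg_right (min_le_right _ _) (by positivity)
    have h10 : k * (dist1 p.1 0 + dist1 q.1 p.1) ≤
        k * ((dist1 p.1 q.1 + w p.1) + (dist1 q.1 p.1 + w' q.1)) :=
      mul_le_mul_of_nonneg_left (by linarith) hk0.le
    linarith
  have hsum : Summable (Function.uncurry fun p q => ⟪b p, F t (b q)⟫_ℂ * ⟪b q, G t (b p)⟫_ℂ) := by
    have hs : Summable fun x : ((ℤ × ℤ) × Fin N) × ((ℤ × ℤ) × Fin N) =>
        C * C' * Real.exp (-k * dist1 x.1.1 0) * Real.exp (-k * dist1 x.2.1 x.1.1) := by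
      refine (summable_prod_of_nonneg fun _ => by positivity).2 ⟨fun p => ?_, ?_⟩
      · exact (summable_exp_dist1 N hk0 p.1).mul_left (C * C' * Real.exp (-k * dist1 p.1 0))
      · simp only [tsum_mul_left, tsum_exp_dist1]
        exact ((summable_exp_dist1 N hk0 0).mul_left _).mul_right _
    exact hs.of_norm_bounded fun x => hbd x.1 x.2
  unfold opTrace
  calc _ = ∑' p, ∑' q, ⟪b p, F t (b q)⟫_ℂ * ⟪b q, G t (b p)⟫_ℂ :=
        tsum_congr fun p => (inner_mul_eq_tsum (F t) (G t) p p).tsum_eq.symm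
    _ = ∑' q, ∑' p, ⟪b p, F t (b q)⟫_ℂ * ⟪b q, G t (b p)⟫_ℂ := hsum.tsum_comm.symm
    _ = _ := tsum_congr fun q => by
        rw [← (inner_mul_eq_tsum (G t) (F t) q q).tsum_eq]
        exact tsum_congr fun p => mul_comm _ _

theorem Confined.opTrace_mul_comm (hF : Confined b T F) (hG : Localized b (Icc 0 T) 0 G)
    (ht : t ∈ Icc 0 T) : opTrace b (F t * G t) = opTrace b (G t * F t) :=
  Localized.opTrace_comm hF hG (isWeight_dist1 0) isWeight_zero (fun m => by simp) ht

/-- Invariance of the trace under unitary conjugation. -/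
theorem Confined.opTrace_conj {U : ℝ → E →L[ℂ] E} (hF : Confined b T F)
    (hU : Localized b (Icc 0 T) 0 U) (ht : t ∈ Icc 0 T) (hu : U t * star (U t) = 1) :
    opTrace b (star (U t) * (F t * U t)) = opTrace b (F t) := by
  rw [← Confined.opTrace_mul_comm (F := fun t => F t * U t) (G := fun t => star (U t))
    (hF.mul_zero hU (isWeight_dist1 0)) hU.star ht, mul_assoc, hu, mul_one]

theorem norm_le_tsum_inner (x : E) (h : Summable fun q => ‖⟪b q, x⟫_ℂ‖) :
    ‖x‖ ≤ ∑' q, ‖⟪b q, x⟫_ℂ‖ := by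
  have h1 := b.hasSum_repr x
  refine h1.norm_le_of_bounded h.hasSum fun q => ?_
  rw [norm_smul, b.orthonormal.1 q, mul_one, b.repr_apply_apply]

/-- This is the criterion for trace class used below: the norm of a column is at most the sum of its
entries, and half of the decay around the origin can be moved from rows to columns. -/
theorem Confined.summable_norm_apply (hF : Confined b T F) (ht : t ∈ Icc 0 T) :
    Summable fun p => ‖F t (b p)‖ := by
  obtain ⟨l, hl, C, hC, hb⟩ := hF
  have hl2 := half_pos hl
  have hbd : ∀ p q : (ℤ × ℤ) × Fin N, ‖⟪b q, F t (b p)⟫_ℂ‖ ≤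
      C * Real.exp (-(l / 2) * dist1 p.1 0) * Real.exp (-(l / 2) * dist1 q.1 p.1) := by
    intro p q
    refine (hb t ht q p).trans ?_
    rw [mul_assoc, ← Real.exp_add]
    gcongr
    have h1 := dist1_triangle p.1 q.1 0
    have h2 := dist1_comm p.1 q.1
    have h3 := dist1_nonneg q.1 0
    nlinarith
  have hs : ∀ p : (ℤ × ℤ) × Fin N, Summable fun q : (ℤ × ℤ) × Fin N =>
      C * Real.exp (-(l / 2) * dist1 p.1 0) * Real.exp (-(l / 2) * dist1 q.1 p.1) :=
    fun p => (summable_exp_dist1 N hl2 p.1).mul_left _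
  have hs' : ∀ p, Summable fun q => ‖⟪b q, F t (b p)⟫_ℂ‖ := fun p =>
    Summable.of_nonneg_of_le (fun _ => norm_nonneg _) (hbd p) (hs p)
  refine Summable.of_nonneg_of_le (fun _ => norm_nonneg _)
    (fun p => (norm_le_tsum_inner _ (hs' p)).trans ((hs' p).tsum_le_tsum (hbd p) (hs p))) ?_
  simp only [tsum_mul_left, tsum_exp_dist1]
  exact ((summable_exp_dist1 N hl2 0).mul_left _).mul_right _

/-- Confinement is uniform in time, so a single summable sequence dominates the diagonal elements
and dominated convergence exchanges trace and integral. -/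
theorem Confined.hasSum_integral (hZ : Z.Countable) (hT : 0 ≤ T) (hF : Confined b T F)
    (hr : StronglyRegular Z T F) :
    IntervalIntegrable (fun t => opTrace b (F t)) volume 0 T ∧
      HasSum (fun p => ∫ t in (0 : ℝ)..T, ⟪b p, F t (b p)⟫_ℂ)
        (∫ t in (0 : ℝ)..T, opTrace b (F t)) := by
  obtain ⟨g, hg, hgb⟩ := hF.exists_bound
  have hT' : T ∈ Icc 0 T := ⟨hT, le_rfl⟩
  have hi := fun p => hr.intervalIntegrable_inner hZ hT' (b p) (b p)
  have hmem : ∀ t ∈ uIoc 0 T, t ∈ Icc 0 T := fun t ht => by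
    rw [uIoc_of_le hT] at ht; exact Ioc_subset_Icc_self ht
  constructor
  · have hm : AEStronglyMeasurable (fun t => opTrace b (F t)) (volume.restrict (uIoc 0 T)) := by
      refine aestronglyMeasurable_of_tendsto_ae (u := atTop)
        (f := fun (S : Finset ((ℤ × ℤ) × Fin N)) t => ∑ p ∈ S, ⟪b p, F t (b p)⟫_ℂ) (fun S => ?_) ?_
      · exact Finset.aestronglyMeasurable_fun_sum S fun p _ => (intervalIntegrable_iff.1 (hi p)).aestronglyMeasurable
      · refine (ae_restrict_iff' measurableSet_uIoc).2 (Eventually.of_forall fun t ht => ?_)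
        exact (hF.diagSummable (hmem t ht)).hasSum
    rw [uIoc_of_le hT] at hm hmem
    refine (intervalIntegrable_iff_integrableOn_Ioc_of_le hT).2
      (Integrable.of_bound hm (∑' p, g p) ?_)
    refine (ae_restrict_iff' measurableSet_Ioc).2 (Eventually.of_forall fun t ht => ?_)
    exact tsum_of_norm_bounded hg.hasSum (hgb t (hmem t ht))
  · refine intervalIntegral.hasSum_integral_of_dominated_convergence (fun p _ => g p)
      (fun p => (intervalIntegrable_iff.1 (hi p)).aestronglyMeasurable)
      (fun p => Eventually.of_forall fun t ht => hgb t (hmem t ht) p)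
      (Eventually.of_forall fun _ _ => hg) (by simp)
      (Eventually.of_forall fun t ht => (hF.diagSummable (hmem t ht)).hasSum)

/-- The fundamental theorem of calculus under the trace. -/
theorem integral_opTrace_strongDeriv (hZ : Z.Countable) (hT : 0 ≤ T) (hF : StronglyContinuous F)
    (h0 : F 0 = 0) (hd : ∀ t ∈ Ioo 0 T \ Z, HasStrongDerivAt F (F' t) t)
    (hF' : StronglyRegular Z T F') (hloc : Confined b T F') :
    ∫ t in (0 : ℝ)..T, opTrace b (F' t) = opTrace b (F T) := by
  refine (hloc.hasSum_integral hZ hT hF').2.tsum_eq.symm.trans (tsum_congr fun p => ?_)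
  rw [integral_inner_strongDeriv hZ hF hd hF' ⟨hT, le_rfl⟩, h0, zero_apply, inner_zero_right,
    sub_zero]

/-- The bound on the matrix elements of the derivative is integrated from time `0`, which multiplies
the constant by `T`. -/
theorem Confined.of_strongDeriv (hZ : Z.Countable) (hF : StronglyContinuous F)
    (h0 : F 0 = 0) (hd : ∀ t ∈ Ioo 0 T \ Z, HasStrongDerivAt F (F' t) t)
    (hF' : StronglyRegular Z T F') (hloc : Confined b T F') : Confined b T F := by
  obtain ⟨l, hl, C, hC, hb⟩ := hloc
  rcases lt_or_ge T 0 with hT | hT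
  · exact ⟨l, hl, C, hC, fun t ht => absurd (ht.1.trans ht.2) (not_le.2 hT)⟩
  refine ⟨l, hl, C * T, by positivity, fun t ht p q => ?_⟩
  have h1 := integral_inner_strongDeriv hZ hF hd hF' ht (b p) (b q)
  rw [h0, zero_apply, inner_zero_right, sub_zero] at h1
  rw [← h1]
  refine (intervalIntegral.norm_integral_le_of_norm_le_const fun τ hτ => hb τ ?_ p q).trans ?_
  · rw [uIoc_of_le ht.1] at hτ
    exact ⟨hτ.1.le, hτ.2.trans ht.2⟩
  · rw [sub_zero, abs_of_nonneg ht.1, mul_right_comm]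
    have := ht.2
    gcongr

end Trace

/-! ### Fluxes and their integrals over a period. -/

section Flux

variable {E : Type} [NormedAddCommGroup E] [InnerProductSpace ℂ E] [CompleteSpace E]
variable {N : ℕ} {b : HilbertBasis ((ℤ × ℤ) × Fin N) ℂ E}
variable {Z : Set ℝ} {T t : ℝ} {H U V : ℝ → E →L[ℂ] E} {L M P K : E →L[ℂ] E}
variable {c c' : ℤ × ℤ → ℤ} {Λ Λ' : SwitchFunction}

/-- The displacement `L - U L U*` of the observable `L` by the evolution. -/
noncomputable def displacement (U : ℝ → E →L[ℂ] E) (L : E →L[ℂ] E) (t : ℝ) : E →L[ℂ] E :=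
  L - U t * (L * star (U t))

/-- The displacement `U* L U - L` of the observable `L` in the Heisenberg picture. -/
noncomputable def heisenberg (U : ℝ → E →L[ℂ] E) (L : E →L[ℂ] E) (t : ℝ) : E →L[ℂ] E :=
  star (U t) * (L * U t) - L

/-- The commutator `[H, L]`. -/
def current (H : ℝ → E →L[ℂ] E) (L : E →L[ℂ] E) (t : ℝ) : E →L[ℂ] E := H t * L - L * H t

variable (b) in
/-- The trace `Tr ([H, L] (M - U M U*))`. -/
noncomputable def flux (H U : ℝ → E →L[ℂ] E) (L M : E →L[ℂ] E) (t : ℝ) : ℂ :=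
  opTrace b (current H L t * displacement U M t)

theorem IsEvolution.displacement_eq (hU : IsEvolution Z T H U) (t : ℝ) :
    displacement U L t = (L * U t - U t * L) * star (U t) := by
  rw [displacement, sub_mul, mul_assoc, hU.mul_star, mul_one, mul_assoc]

theorem IsEvolution.heisenberg_eq (hU : IsEvolution Z T H U) (t : ℝ) :
    heisenberg U L t = star (U t) * (L * U t - U t * L) := by
  rw [heisenberg, mul_sub, ← mul_assoc _ (U t) L, hU.star_mul, one_mul]

/-- This intertwining converts Heisenberg displacements into Schrödinger ones, so that the outer
factors `U*` and `U` drop out under the trace. -/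
theorem IsEvolution.mul_heisenberg (hU : IsEvolution Z T H U) (t : ℝ) :
    U t * heisenberg U L t = displacement U L t * U t := by
  rw [hU.heisenberg_eq, hU.displacement_eq, mul_assoc _ _ (U t), hU.star_mul, ← mul_assoc,
    hU.mul_star, one_mul, mul_one]

theorem IsEvolution.heisenberg_eq_conj (hU : IsEvolution Z T H U) (t : ℝ) :
    heisenberg U L t = star (U t) * (displacement U L t * U t) := by
  rw [← hU.mul_heisenberg, ← mul_assoc, hU.star_mul, one_mul]

theorem IsSwitch.localized_displacement (hL : IsSwitch b c Λ L) (hc : IsCoord c)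
    (hU : IsEvolution Z T H U) (hUl : Localized b (Icc 0 T) 0 U) :
    Localized b (Icc 0 T) (fun m => |(c m : ℝ)|) (displacement U L) :=
  ((hL.localized_commutator hc hUl).mul_zero hUl.star hc.isWeight).congr
    fun t _ => hU.displacement_eq t

theorem IsSwitch.localized_heisenberg (hL : IsSwitch b c Λ L) (hc : IsCoord c)
    (hU : IsEvolution Z T H U) (hUl : Localized b (Icc 0 T) 0 U) :
    Localized b (Icc 0 T) (fun m => |(c m : ℝ)|) (heisenberg U L) :=
  (hUl.star.zero_mul (hL.localized_commutator hc hUl) hc.isWeight).congr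
    fun t _ => hU.heisenberg_eq t

theorem IsSwitch.localized_current (hL : IsSwitch b c Λ L) (hc : IsCoord c)
    (hHl : Localized b (Icc 0 T) 0 H) :
    Localized b (Icc 0 T) (fun m => |(c m : ℝ)|) (current H L) :=
  ((hL.localized_commutator hc hHl).const_smul (-1)).congr fun t _ => by
    rw [current, neg_one_smul, neg_sub]

theorem IsEvolution.stronglyContinuous_heisenberg (hU : IsEvolution Z T H U) :
    StronglyContinuous (heisenberg U L) :=
  (hU.stronglyContinuous_star.mul
    ((stronglyContinuous_const L).mul hU.stronglyContinuous)).sub (stronglyContinuous_const L)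

theorem IsEvolution.stronglyContinuous_displacement (hU : IsEvolution Z T H U) :
    StronglyContinuous (displacement U L) :=
  (stronglyContinuous_const L).sub (hU.stronglyContinuous.mul
    ((stronglyContinuous_const L).mul hU.stronglyContinuous_star))

theorem StronglyRegular.current (hH : StronglyRegular Z T H) :
    StronglyRegular Z T (current H L) :=
  (hH.mul (stronglyRegular_const L)).sub ((stronglyRegular_const L).mul hH)

theorem IsEvolution.heisenberg_zero (hU : IsEvolution Z T H U) : heisenberg U L 0 = 0 := by
  rw [heisenberg, hU.zero, star_one, one_mul, mul_one, sub_self]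

theorem heisenberg_eq_zero (h : U t = 1) : heisenberg U L t = 0 := by
  rw [heisenberg, h, star_one, one_mul, mul_one, sub_self]

theorem IsEvolution.deriv_heisenberg (hU : IsEvolution Z T H U) (ht : t ∈ Ioo 0 T \ Z) :
    HasStrongDerivAt (heisenberg U L)
      (Complex.I • (star (U t) * (current H L t * U t))) t := by
  have h1 := (hU.deriv_star ht).mul ((hU.deriv t ht).const_mul L)
    (Eventually.of_forall hU.stronglyContinuous_star.bound.choose_spec)
  have h2 := h1.sub (hasStrongDerivAt_const L t)
  have e : Complex.I • (star (U t) * (current H L t * U t)) =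
      Complex.I • (star (U t) * H t) * (L * U t) +
        star (U t) * (L * -Complex.I • (H t * U t)) - 0 := by
    simp only [current, sub_mul, mul_sub, smul_sub, smul_mul_assoc, mul_smul_comm, neg_smul,
      mul_neg, sub_zero, mul_assoc]
    rw [sub_eq_add_neg]
  rw [e]
  exact h2

/-- Two complementary coordinates of `ℤ²`. -/
structure IsCoordPair (c c' : ℤ × ℤ → ℤ) : Prop where
  fst : IsCoord c
  snd : IsCoord c'
  cover : ∀ m, dist1 m 0 ≤ |(c m : ℝ)| + |(c' m : ℝ)|

theorem IsCoordPair.symm (h : IsCoordPair c c') : IsCoordPair c' c :=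
  ⟨h.snd, h.fst, fun m => (h.cover m).trans_eq (add_comm _ _)⟩

theorem isCoordPair_fst_snd : IsCoordPair Prod.fst Prod.snd :=
  ⟨isCoord_fst, isCoord_snd, fun m => by simp [dist1]⟩

variable (b) in
/-- An evolution on `[0,T]` that is local together with its generator. -/
structure IsLocalEvolution (Z : Set ℝ) (T : ℝ) (H U : ℝ → E →L[ℂ] E) : Prop
    extends IsEvolution Z T H U where
  countable : Z.Countable
  nonneg : 0 ≤ T
  regular : StronglyRegular Z T H
  localized_generator : Localized b (Icc 0 T) 0 H
  localized : Localized b (Icc 0 T) 0 U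

theorem IsLocalEvolution.confined_flux (hU : IsLocalEvolution b Z T H U) (hcc : IsCoordPair c c')
    (hL : IsSwitch b c Λ L) (hM : IsSwitch b c' Λ' M) :
    Confined b T (fun t => current H L t * displacement U M t) :=
  (hL.localized_current hcc.fst hU.localized_generator).mul
    (hM.localized_displacement hcc.snd hU.toIsEvolution hU.localized) hcc.fst.isWeight
    hcc.snd.isWeight hcc.cover

theorem IsLocalEvolution.intervalIntegrable_flux (hU : IsLocalEvolution b Z T H U)
    (hcc : IsCoordPair c c') (hL : IsSwitch b c Λ L) (hM : IsSwitch b c' Λ' M) :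
    IntervalIntegrable (flux b H U L M) volume 0 T :=
  ((hU.confined_flux hcc hL hM).hasSum_integral hU.countable hU.nonneg
    (hU.regular.current.mul hU.stronglyContinuous_displacement.stronglyRegular)).1

/-- The integrated flux over a period is antisymmetric. -/
theorem IsLocalEvolution.integral_flux_antisymm (hU : IsLocalEvolution b Z T H U) (hper : U T = 1)
    (hcc : IsCoordPair c c') (hL : IsSwitch b c Λ L) (hM : IsSwitch b c' Λ' M) :
    ∫ t in (0 : ℝ)..T, flux b H U L M t = -∫ t in (0 : ℝ)..T, flux b H U M L t := by
  have hw := isWeight_dist1 0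
  -- `X` is the derivative of the product of the two Heisenberg displacements, which vanishes at `0`
  -- and at `T`; hence its integrated trace is zero.
  set X := fun t => Complex.I • (star (U t) * (current H L t * U t)) * heisenberg U M t +
    heisenberg U L t * Complex.I • (star (U t) * (current H M t * U t)) with hX
  have hd : ∀ t ∈ Ioo 0 T \ Z,
      HasStrongDerivAt (fun t => heisenberg U L t * heisenberg U M t) (X t) t := fun t ht =>
    (hU.deriv_heisenberg ht).mul (hU.deriv_heisenberg ht)
      (Eventually.of_forall hU.stronglyContinuous_heisenberg.bound.choose_spec)
  have hXe : ∀ t, X t = Complex.I •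
      (star (U t) * ((current H L t * displacement U M t) * U t) +
        star (U t) * ((displacement U L t * current H M t) * U t)) := by
    intro t
    simp only [hX]
    rw [hU.heisenberg_eq_conj (L := L), smul_mul_assoc, mul_smul_comm, ← smul_add, mul_assoc,
      mul_assoc _ (U t) (heisenberg U M t), hU.mul_heisenberg]
    simp only [mul_assoc]
    rw [← mul_assoc (U t) (star (U t)), hU.mul_star, one_mul]
  have hc1 := hU.confined_flux hcc hL hM
  have hdl := hL.localized_displacement hcc.fst hU.toIsEvolution hU.localized
  have hcur := hM.localized_current hcc.snd hU.localized_generator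
  have hc2 : Confined b T (fun t => displacement U L t * current H M t) :=
    hdl.mul hcur hcc.fst.isWeight hcc.snd.isWeight hcc.cover
  have hc1' : Confined b T (fun t => star (U t) * ((current H L t * displacement U M t) * U t)) :=
    hU.localized.star.zero_mul (hc1.mul_zero hU.localized hw) hw
  have hc2' : Confined b T (fun t => star (U t) * ((displacement U L t * current H M t) * U t)) :=
    hU.localized.star.zero_mul (hc2.mul_zero hU.localized hw) hw
  have hXc : Confined b T X := ((hc1'.add hw hc2').const_smul Complex.I).congr fun t _ => hXe t
  have hcr : ∀ K : E →L[ℂ] E, StronglyRegular Z T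
      (fun t => Complex.I • (star (U t) * (current H K t * U t))) := fun K =>
    (hU.stronglyContinuous_star.stronglyRegular.mul
      (hU.regular.current.mul hU.stronglyContinuous.stronglyRegular)).const_smul _
  have hXr : StronglyRegular Z T X :=
    ((hcr L).mul hU.stronglyContinuous_heisenberg.stronglyRegular).add
      (hU.stronglyContinuous_heisenberg.stronglyRegular.mul (hcr M))
  have hftc := integral_opTrace_strongDeriv hU.countable hU.nonneg
    (hU.stronglyContinuous_heisenberg.mul hU.stronglyContinuous_heisenberg)
    (by rw [hU.heisenberg_zero, MulZeroClass.zero_mul]) hd hXr hXc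
  have hT : opTrace b (heisenberg U L T * heisenberg U M T) = 0 := by
    rw [heisenberg_eq_zero hper, MulZeroClass.zero_mul]
    simp [opTrace]
  have htr : ∀ t ∈ uIcc 0 T,
      opTrace b (X t) = Complex.I * (flux b H U L M t + flux b H U M L t) := by
    intro t ht
    rw [uIcc_of_le hU.nonneg] at ht
    rw [hXe, opTrace_smul, opTrace_add (hc1'.diagSummable ht) (hc2'.diagSummable ht),
      hc1.opTrace_conj hU.localized ht (hU.mul_star t),
      hc2.opTrace_conj hU.localized ht (hU.mul_star t),
      -- Each factor is localized in one direction only; the two weights together still allow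
      -- cyclicity.
      hdl.opTrace_comm hcur hcc.fst.isWeight hcc.snd.isWeight hcc.cover ht]
    rfl
  rw [hT, intervalIntegral.integral_congr htr, intervalIntegral.integral_const_mul,
    intervalIntegral.integral_add (hU.intervalIntegrable_flux hcc hL hM)
      (hU.intervalIntegrable_flux hcc.symm hM hL)] at hftc
  exact eq_neg_of_add_eq_zero_left ((mul_eq_zero.1 hftc).resolve_left Complex.I_ne_zero)

/-- The diagonal of such a commutator vanishes identically, for every bounded `K`. It is applied to
products that need not be trace class. -/
theorem IsDiagonal.opTrace_commutator {f : ℤ × ℤ → ℝ} (hL : IsDiagonal b f L) (K : E →L[ℂ] E) :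
    opTrace b (K * L - L * K) = 0 := by
  have : ∀ p, ⟪b p, (K * L - L * K) (b p)⟫_ℂ = 0 := fun p => by
    rw [sub_apply, inner_sub_right, hL.inner_left, hL.inner_right, sub_self]
  simp only [opTrace, this, tsum_zero]

theorem IsDiagonal.diagSummable_commutator {f : ℤ × ℤ → ℝ} (hL : IsDiagonal b f L)
    (K : E →L[ℂ] E) : DiagSummable b (K * L - L * K) := by
  have : ∀ p, ⟪b p, (K * L - L * K) (b p)⟫_ℂ = 0 := fun p => by
    rw [sub_apply, inner_sub_right, hL.inner_left, hL.inner_right, sub_self]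
  simpa only [DiagSummable, this] using summable_zero

/-- The integrated flux over a period does not depend on the second switch function. -/
theorem IsLocalEvolution.integral_flux_congr (hU : IsLocalEvolution b Z T H U) (hper : U T = 1)
    (hcc : IsCoordPair c c') {Λ'' : SwitchFunction} {M' : E →L[ℂ] E} (hL : IsSwitch b c Λ L)
    (hM : IsSwitch b c' Λ' M) (hM' : IsSwitch b c' Λ'' M') :
    ∫ t in (0 : ℝ)..T, flux b H U L M t = ∫ t in (0 : ℝ)..T, flux b H U L M' t := by
  have hw := isWeight_dist1 0
  have hf : IsDiagonal b _ (M - M') := IsDiagonal.sub hM hM'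
  have hfl : Localized b (Icc 0 T) (fun m => |(c' m : ℝ)|) (fun _ => M - M') :=
    hM.localized_sub hM'
  have hcur := hL.localized_current hcc.fst hU.localized_generator
  have hcf : Confined b T (fun t => current H L t * (M - M')) :=
    hcur.mul hfl hcc.fst.isWeight hcc.snd.isWeight hcc.cover
  have hcuf : Confined b T (fun t => current H L t * (U t * (M - M'))) :=
    hcur.mul (hU.localized.zero_mul hfl hcc.snd.isWeight) hcc.fst.isWeight hcc.snd.isWeight
      hcc.cover
  have hcufu : Confined b T (fun t => current H L t * (U t * (M - M')) * star (U t)) :=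
    hcuf.mul_zero hU.localized.star hw
  -- The derivative of `(U* L U - L) (M - M')`. Its trace gives the part of the flux difference that
  -- contains `U (M - M') U*`.
  set X := fun t => Complex.I • (star (U t) * (current H L t * U t)) * (M - M') with hX
  have hXe : ∀ t, X t = Complex.I • (star (U t) * (current H L t * (U t * (M - M')))) := by
    intro t
    simp only [hX, smul_mul_assoc, mul_assoc]
  have hXc : Confined b T X :=
    ((hU.localized.star.zero_mul hcuf hw).const_smul Complex.I).congr fun t _ => hXe t
  have hXr : StronglyRegular Z T X :=
    ((hU.stronglyContinuous_star.stronglyRegular.mul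
      (hU.regular.current.mul hU.stronglyContinuous.stronglyRegular)).const_smul _).mul
      (stronglyRegular_const _)
  have hftc := integral_opTrace_strongDeriv hU.countable hU.nonneg
    (hU.stronglyContinuous_heisenberg.mul (stronglyContinuous_const (M - M')))
    (by rw [hU.heisenberg_zero, MulZeroClass.zero_mul])
    (fun t ht => (hU.deriv_heisenberg (L := L) ht).mul_const (M - M')) hXr hXc
  have hT : opTrace b (heisenberg U L T * (M - M')) = 0 := by
    rw [heisenberg_eq_zero hper, MulZeroClass.zero_mul]
    simp [opTrace]
  have htr : ∀ t ∈ uIcc 0 T,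
      opTrace b (X t) = -Complex.I * (flux b H U L M t - flux b H U L M' t) := by
    intro t ht
    rw [uIcc_of_le hU.nonneg] at ht
    have e1 : current H L t * displacement U M t - current H L t * displacement U M' t =
        current H L t * (M - M') - current H L t * (U t * (M - M')) * star (U t) := by
      simp only [displacement, mul_sub, sub_mul, mul_assoc]
      abel
    -- The remaining part of the flux difference has no trace: `M - M'` commutes with `L`, so the
    -- product is a commutator with the diagonal operator `L`.
    have e2 : current H L t * (M - M') = (H t * (M - M')) * L - L * (H t * (M - M')) := by
      rw [current, sub_mul, mul_assoc, mul_assoc, hL.commute hf, mul_assoc]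
    have e3 : opTrace b (current H L t * (M - M')) = 0 := by
      rw [e2]; exact hL.opTrace_commutator _
    rw [hXe, opTrace_smul, flux, flux,
      ← opTrace_sub ((hU.confined_flux hcc hL hM).diagSummable ht)
        ((hU.confined_flux hcc hL hM').diagSummable ht), e1,
      opTrace_sub (hcf.diagSummable ht) (hcufu.diagSummable ht), e3,
      hcuf.opTrace_mul_comm hU.localized.star ht]
    ring
  rw [hT, intervalIntegral.integral_congr htr, intervalIntegral.integral_const_mul,
    intervalIntegral.integral_sub (hU.intervalIntegrable_flux hcc hL hM)
      (hU.intervalIntegrable_flux hcc hL hM')] at hftc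
  exact sub_eq_zero.1 ((mul_eq_zero.1 hftc).resolve_left (neg_ne_zero.2 Complex.I_ne_zero))

end Flux

/-! ### The bulk and edge traces as fluxes. -/

section Correspondence

variable {E : Type} [NormedAddCommGroup E] [InnerProductSpace ℂ E] [CompleteSpace E]
variable {N : ℕ} {b : HilbertBasis ((ℤ × ℤ) × Fin N) ℂ E}
variable {Z : Set ℝ} {T t : ℝ} {H U V : ℝ → E →L[ℂ] E} {L M P : E →L[ℂ] E}
variable {c c' : ℤ × ℤ → ℤ} {Λ Λ' : SwitchFunction}

theorem IsLocalEvolution.confined_heisenberg_lie (hU : IsLocalEvolution b Z T H U)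
    (hcc : IsCoordPair c c') (hL : IsSwitch b c Λ L) (hM : IsSwitch b c' Λ' M) :
    Confined b T (fun t => heisenberg U L t * heisenberg U M t -
      heisenberg U M t * heisenberg U L t) := by
  have h1 := hL.localized_heisenberg hcc.fst hU.toIsEvolution hU.localized
  have h2 := hM.localized_heisenberg hcc.snd hU.toIsEvolution hU.localized
  exact (h1.mul h2 hcc.fst.isWeight hcc.snd.isWeight hcc.cover).sub (isWeight_dist1 0)
    (h2.mul h1 hcc.snd.isWeight hcc.fst.isWeight hcc.symm.cover)

/-- The trace of the bulk operator in terms of fluxes. -/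
theorem IsLocalEvolution.opTrace_bulk (hU : IsLocalEvolution b Z T H U)
    (hcc : IsCoordPair c c') (hL : IsSwitch b c Λ L) (hM : IsSwitch b c' Λ' M)
    (ht : t ∈ Icc 0 T) :
    opTrace b (star (U t) * ((-Complex.I) • (H t * U t)) *
      (heisenberg U L t * heisenberg U M t - heisenberg U M t * heisenberg U L t)) =
      -Complex.I * (flux b H U L M t - flux b H U M L t) := by
  have hw := isWeight_dist1 0
  have hdl := hL.localized_displacement hcc.fst hU.toIsEvolution hU.localized
  have hdm := hM.localized_displacement hcc.snd hU.toIsEvolution hU.localized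
  have hc : Confined b T (fun t => H t * (displacement U L t * displacement U M t -
      displacement U M t * displacement U L t)) :=
    hU.localized_generator.zero_mul
      ((hdl.mul hdm hcc.fst.isWeight hcc.snd.isWeight hcc.cover).sub hw
        (hdm.mul hdl hcc.snd.isWeight hcc.fst.isWeight hcc.symm.cover)) hw
  have e0 : ∀ A B : E →L[ℂ] E, U t * (heisenberg U A t * heisenberg U B t) =
      displacement U A t * displacement U B t * U t := fun A B => by
    rw [← mul_assoc, hU.mul_heisenberg, mul_assoc, hU.mul_heisenberg, mul_assoc]
  have e1 : star (U t) * ((-Complex.I) • (H t * U t)) *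
      (heisenberg U L t * heisenberg U M t - heisenberg U M t * heisenberg U L t) =
      (-Complex.I) • (star (U t) * (H t * (displacement U L t * displacement U M t -
        displacement U M t * displacement U L t) * U t)) := by
    rw [mul_smul_comm, smul_mul_assoc, mul_assoc, mul_assoc (H t), mul_sub (U t), e0, e0, ← sub_mul,
      mul_assoc (H t)]
  have hLM : L * M = M * L := IsDiagonal.commute hL hM
  -- The commutators `[L, M]` and `[U L U*, U M U*]` both vanish, leaving only the mixed terms.
  have e2 : displacement U L t * displacement U M t - displacement U M t * displacement U L t =
      (L * displacement U M t - displacement U M t * L) -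
        (M * displacement U L t - displacement U L t * M) := by
    have e3 : (U t * (L * star (U t))) * (U t * (M * star (U t))) =
        (U t * (M * star (U t))) * (U t * (L * star (U t))) := by
      have : ∀ A B : E →L[ℂ] E, (U t * (A * star (U t))) * (U t * (B * star (U t))) =
          U t * ((A * B) * star (U t)) := fun A B => by
        simp only [mul_assoc]
        rw [← mul_assoc (star (U t)) (U t), hU.star_mul, one_mul]
      rw [this, this, hLM]
    simp only [displacement, mul_sub, sub_mul]
    rw [e3, hLM]
    abel
  -- `H [L, D] = [H, L] D - [H D, L]`, and likewise for `M`; the commutators with `L` and `M` have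
  -- zero diagonal.
  have e4 : H t * (displacement U L t * displacement U M t -
      displacement U M t * displacement U L t) =
      (current H L t * displacement U M t - current H M t * displacement U L t) -
        (((H t * displacement U M t) * L - L * (H t * displacement U M t)) -
          ((H t * displacement U L t) * M - M * (H t * displacement U L t))) := by
    rw [e2]
    simp only [current, mul_sub, sub_mul, mul_assoc]
    abel
  have d1 := (hU.confined_flux hcc hL hM).diagSummable ht
  have d2 := (hU.confined_flux hcc.symm hM hL).diagSummable ht
  have d3 := IsDiagonal.diagSummable_commutator hL (H t * displacement U M t)
  have d4 := IsDiagonal.diagSummable_commutator hM (H t * displacement U L t)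
  have dsub : ∀ {A B : E →L[ℂ] E}, DiagSummable b A → DiagSummable b B → DiagSummable b (A - B) :=
    fun hA hB => (Summable.sub hA hB).congr fun p => by rw [sub_apply, inner_sub_right]
  rw [e1, opTrace_smul, hc.opTrace_conj hU.localized ht (hU.mul_star t), e4,
    opTrace_sub (dsub d1 d2) (dsub d3 d4), opTrace_sub d1 d2, opTrace_sub d3 d4,
    IsDiagonal.opTrace_commutator hL, IsDiagonal.opTrace_commutator hM, sub_zero, sub_zero]
  rfl

/-- The Heisenberg evolution of `M` under `V`, relative to that under `U`, compressed to `P`. -/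
noncomputable def edgeDefect (U V : ℝ → E →L[ℂ] E) (M P : E →L[ℂ] E) (t : ℝ) : E →L[ℂ] E :=
  P * (star (V t) * (U t * (M * star (U t)) * V t) - M) * P

/-- The generator of `edgeDefect`, conjugated with `V`. -/
noncomputable def edgeSource (H U : ℝ → E →L[ℂ] E) (M P : E →L[ℂ] E) (t : ℝ) : E →L[ℂ] E :=
  P * H t * (1 - P) * (displacement U M t * P) - P * displacement U M t * ((1 - P) * H t * P)

/-- The setting of the bulk-edge correspondence: `V` is the evolution generated by the compression
of `H` to the half space with projection `P`. -/
structure IsEdgeEvolution (b : HilbertBasis ((ℤ × ℤ) × Fin N) ℂ E) (c : ℤ × ℤ → ℤ)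
    (Λ : SwitchFunction) (Z : Set ℝ) (T : ℝ) (H V : ℝ → E →L[ℂ] E) (P : E →L[ℂ] E) : Prop where
  switch : IsSwitch b c Λ P
  idem : P * P = P
  evolution : IsLocalEvolution b Z T (fun t => P * H t * P) V
  commute : ∀ t, P * V t = V t * P

theorem IsEdgeEvolution.commute_star (hV : IsEdgeEvolution b c Λ Z T H V P) (t : ℝ) :
    P * star (V t) = star (V t) * P := by
  have h := congrArg star (hV.commute t)
  rw [StarMul.star_mul, StarMul.star_mul, IsDiagonal.isSelfAdjoint hV.switch] at h
  exact h.symm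

theorem IsEdgeEvolution.localized_compl (hV : IsEdgeEvolution b c Λ Z T H V P) (s : Set ℝ) :
    Localized b s 0 (fun _ => 1 - P) := by
  have h1 : IsDiagonal b (fun _ => 1) (1 : E →L[ℂ] E) := fun p => by simp
  obtain ⟨C, hC, hb⟩ := Λ.bounded
  exact (h1.sub hV.switch).localized_zero (add_nonneg zero_le_one hC) fun m =>
    (abs_sub _ _).trans (add_le_add (by simp) (hb _))

theorem IsEdgeEvolution.localized_corner (hV : IsEdgeEvolution b c Λ Z T H V P)
    (hc : IsCoord c) (hHl : Localized b (Icc 0 T) 0 H) :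
    Localized b (Icc 0 T) (fun m => |(c m : ℝ)|) (fun t => P * H t * (1 - P)) := by
  refine (((hV.switch.localized_current hc hHl).mul_zero (hV.localized_compl _)
    hc.isWeight).const_smul (-1)).congr fun t _ => ?_
  rw [neg_one_smul, current]
  simp only [mul_sub, sub_mul, mul_one, mul_assoc, hV.idem]
  abel

theorem IsEdgeEvolution.localized_corner' (hV : IsEdgeEvolution b c Λ Z T H V P)
    (hc : IsCoord c) (hHl : Localized b (Icc 0 T) 0 H) :
    Localized b (Icc 0 T) (fun m => |(c m : ℝ)|) (fun t => (1 - P) * H t * P) := by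
  refine ((hV.switch.localized_current hc hHl).mul_zero hV.switch.localized
    hc.isWeight).congr fun t _ => ?_
  rw [current]
  simp only [sub_mul, one_mul, mul_assoc, hV.idem]

theorem IsEdgeEvolution.confined_source_left (hV : IsEdgeEvolution b c Λ Z T H V P)
    (hU : IsLocalEvolution b Z T H U) (hcc : IsCoordPair c c') (hM : IsSwitch b c' Λ' M) :
    Confined b T (fun t => P * H t * (1 - P) * (displacement U M t * P)) :=
  (hV.localized_corner hcc.fst hU.localized_generator).mul
    ((hM.localized_displacement hcc.snd hU.toIsEvolution hU.localized).mul_zero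
      hV.switch.localized hcc.snd.isWeight) hcc.fst.isWeight hcc.snd.isWeight hcc.cover

theorem IsEdgeEvolution.localized_mul_displacement (hV : IsEdgeEvolution b c Λ Z T H V P)
    (hU : IsLocalEvolution b Z T H U) (hc' : IsCoord c') (hM : IsSwitch b c' Λ' M) :
    Localized b (Icc 0 T) (fun m => |(c' m : ℝ)|) (fun t => P * displacement U M t) :=
  Localized.zero_mul (F := fun _ => P) hV.switch.localized
    (hM.localized_displacement hc' hU.toIsEvolution hU.localized) hc'.isWeight

theorem IsEdgeEvolution.confined_source_right (hV : IsEdgeEvolution b c Λ Z T H V P)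
    (hU : IsLocalEvolution b Z T H U) (hcc : IsCoordPair c c') (hM : IsSwitch b c' Λ' M) :
    Confined b T (fun t => P * displacement U M t * ((1 - P) * H t * P)) :=
  (hV.localized_mul_displacement hU hcc.snd hM).mul
    (hV.localized_corner' hcc.fst hU.localized_generator) hcc.snd.isWeight hcc.fst.isWeight
    hcc.symm.cover

theorem IsEdgeEvolution.confined_source (hV : IsEdgeEvolution b c Λ Z T H V P)
    (hU : IsLocalEvolution b Z T H U) (hcc : IsCoordPair c c') (hM : IsSwitch b c' Λ' M) :
    Confined b T (edgeSource H U M P) :=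
  (hV.confined_source_left hU hcc hM).sub (isWeight_dist1 0) (hV.confined_source_right hU hcc hM)

/-- Cyclicity removes the outer `P` from the first corner term and brings the corner to the left in
the second. What is left is `P H (1 - P) - (1 - P) H P = -[H, P]` times the displacement. -/
theorem IsEdgeEvolution.opTrace_source (hV : IsEdgeEvolution b c Λ Z T H V P)
    (hU : IsLocalEvolution b Z T H U) (hcc : IsCoordPair c c') (hM : IsSwitch b c' Λ' M)
    (ht : t ∈ Icc 0 T) : opTrace b (edgeSource H U M P t) = -flux b H U P M t := by
  have hA := hV.localized_corner hcc.fst hU.localized_generator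
  have hB := hV.localized_corner' hcc.fst hU.localized_generator
  have hPd := hV.localized_mul_displacement hU hcc.snd hM
  have hdm := hM.localized_displacement hcc.snd hU.toIsEvolution hU.localized
  have c1 : Confined b T (fun t => P * H t * (1 - P) * displacement U M t) :=
    hA.mul hdm hcc.fst.isWeight hcc.snd.isWeight hcc.cover
  have c2 : Confined b T (fun t => (1 - P) * H t * P * (P * displacement U M t)) :=
    hB.mul hPd hcc.fst.isWeight hcc.snd.isWeight hcc.cover
  have d1 := c1.diagSummable ht
  have d3 := (hV.confined_source_left hU hcc hM).diagSummable ht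
  have d4 := (hV.confined_source_right hU hcc hM).diagSummable ht
  have d2 := c2.diagSummable ht
  have e1 : opTrace b (P * H t * (1 - P) * (displacement U M t * P)) =
      opTrace b (P * H t * (1 - P) * displacement U M t) := by
    have e : P * (P * H t * (1 - P) * displacement U M t) =
        P * H t * (1 - P) * displacement U M t := by
      rw [← mul_assoc, ← mul_assoc, ← mul_assoc, hV.idem]
    rw [← mul_assoc, IsDiagonal.opTrace_comm hV.switch, e]
  have e2 := hPd.opTrace_comm hB hcc.snd.isWeight hcc.fst.isWeight hcc.symm.cover ht
  beta_reduce at e2 d1 d2 d3 d4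
  have e3 : P * H t * (1 - P) * displacement U M t -
      (1 - P) * H t * P * (P * displacement U M t) =
      (-1 : ℂ) • (current H P t * displacement U M t) := by
    rw [neg_one_smul, current, ← mul_assoc _ P, mul_assoc _ P P, hV.idem]
    simp only [mul_sub, sub_mul, mul_one, one_mul]
    abel
  rw [edgeSource, opTrace_sub d3 d4, e1, e2, ← opTrace_sub d1 d2, e3,
    opTrace_smul, neg_one_mul, flux]

/-- With `Y = U M U*`, the generators `H` of `Y` and `P H P` of `V` cancel after compression by `P`,
except for the corners that couple the two half spaces. -/
theorem IsEdgeEvolution.deriv_defect (hV : IsEdgeEvolution b c Λ Z T H V P)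
    (hU : IsLocalEvolution b Z T H U) (hM : IsSwitch b c' Λ' M) (ht : t ∈ Ioo 0 T \ Z) :
    HasStrongDerivAt (edgeDefect U V M P)
      (Complex.I • (star (V t) * (edgeSource H U M P t * V t))) t := by
  have hY := (hU.deriv t ht).mul ((hU.deriv_star ht).const_mul M)
    (Eventually.of_forall hU.stronglyContinuous.bound.choose_spec)
  have hYs := hU.stronglyContinuous.mul
    ((stronglyContinuous_const M).mul hU.stronglyContinuous_star)
  have hYV := hY.mul (hV.evolution.deriv t ht) (Eventually.of_forall hYs.bound.choose_spec)
  have hVYV := (hV.evolution.deriv_star ht).mul hYV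
    (Eventually.of_forall hV.evolution.stronglyContinuous_star.bound.choose_spec)
  have h := ((hVYV.sub (hasStrongDerivAt_const M t)).const_mul P).mul_const P
  refine cast (congrArg (fun A => HasStrongDerivAt (edgeDefect U V M P) A t) ?_) h
  set Y := U t * (M * star (U t)) with hYdef
  have hd : displacement U M t = M - Y := rfl
  have e1 : (-Complex.I) • (H t * U t) * (M * star (U t)) +
      U t * (M * Complex.I • (star (U t) * H t)) = Complex.I • (Y * H t - H t * Y) := by
    simp only [hYdef, smul_mul_assoc, mul_smul_comm, mul_assoc, neg_smul, neg_mul, smul_sub]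
    abel
  have hMP : M * P = P * M := IsDiagonal.commute hM hV.switch
  set R := P * H t * P * Y + (Y * H t - H t * Y) - Y * (P * H t * P) with hR
  have e2 : edgeSource H U M P t = P * R * P := by
    -- `M` commutes with `P`, so it drops out of the off-diagonal blocks and the displacement may
    -- replace `-Y` there. This is what makes the source decay in the second direction.
    have f1 : (1 - P) * ((M - Y) * P) = (P - 1) * (Y * P) := by
      simp only [sub_mul, mul_sub, one_mul]
      rw [hMP, ← mul_assoc P P, hV.idem]
      abel
    have f2 : P * (M - Y) * (1 - P) = P * Y * (P - 1) := by
      simp only [sub_mul, mul_sub, mul_one]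
      rw [mul_assoc P M P, hMP, ← mul_assoc P P, hV.idem]
      abel
    have f3 : ∀ A : E →L[ℂ] E, P * (P * A) = P * A := fun A => by rw [← mul_assoc, hV.idem]
    rw [edgeSource, hd, mul_assoc (P * H t), f1, mul_assoc (1 - P), ← mul_assoc _ (1 - P), f2, hR]
    simp only [sub_mul, mul_sub, add_mul, mul_add, one_mul, mul_one, mul_assoc, f3, hV.idem]
    abel
  have e3 : Complex.I • (star (V t) * (P * H t * P)) * (Y * V t) + star (V t) *
      (Complex.I • (Y * H t - H t * Y) * V t + Y * -Complex.I • (P * H t * P * V t)) - 0 =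
      Complex.I • (star (V t) * (R * V t)) := by
    rw [hR]
    simp only [smul_mul_assoc, mul_smul_comm, neg_smul, mul_neg, sub_zero, add_mul, sub_mul,
      mul_add, mul_sub, smul_add, smul_sub, mul_assoc]
    abel
  have e4 : P * (star (V t) * (R * V t)) * P = star (V t) * (P * R * P * V t) := by
    rw [← mul_assoc P, hV.commute_star t, mul_assoc (star (V t) * P), mul_assoc R, ← hV.commute t]
    simp only [mul_assoc]
  rw [e1, e3, e2, mul_smul_comm, smul_mul_assoc, e4]

theorem IsEdgeEvolution.stronglyContinuous_defect (hV : IsEdgeEvolution b c Λ Z T H V P)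
    (hU : IsLocalEvolution b Z T H U) : StronglyContinuous (edgeDefect U V M P) :=
  ((stronglyContinuous_const P).mul
    ((hV.evolution.stronglyContinuous_star.mul ((hU.stronglyContinuous.mul
      ((stronglyContinuous_const M).mul hU.stronglyContinuous_star)).mul
        hV.evolution.stronglyContinuous)).sub (stronglyContinuous_const M))).mul
    (stronglyContinuous_const P)

/-- The edge trace as an integrated flux through the boundary of the half space. -/
theorem IsEdgeEvolution.opTrace_defect (hV : IsEdgeEvolution b c Λ Z T H V P)
    (hU : IsLocalEvolution b Z T H U) (hcc : IsCoordPair c c') (hM : IsSwitch b c' Λ' M) :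
    Confined b T (edgeDefect U V M P) ∧
      opTrace b (edgeDefect U V M P T) = -Complex.I * ∫ t in (0 : ℝ)..T, flux b H U P M t := by
  have hw := isWeight_dist1 0
  have hQ := hV.confined_source hU hcc hM
  have hX : Confined b T (fun t => Complex.I • (star (V t) * (edgeSource H U M P t * V t))) :=
    (hV.evolution.localized.star.zero_mul (hQ.mul_zero hV.evolution.localized hw) hw).const_smul _
  have hB : StronglyRegular Z T (displacement U M) :=
    hU.stronglyContinuous_displacement.stronglyRegular
  have hK : ∀ K : E →L[ℂ] E, StronglyRegular Z T (fun _ => K) := stronglyRegular_const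
  have hQr : StronglyRegular Z T (edgeSource H U M P) :=
    ((((hK P).mul hU.regular).mul (hK (1 - P))).mul (hB.mul (hK P))).sub
      (((hK P).mul hB).mul (((hK (1 - P)).mul hU.regular).mul (hK P)))
  have hXr : StronglyRegular Z T
      (fun t => Complex.I • (star (V t) * (edgeSource H U M P t * V t))) :=
    (hV.evolution.stronglyContinuous_star.stronglyRegular.mul
      (hQr.mul hV.evolution.stronglyContinuous.stronglyRegular)).const_smul _
  have hc := hV.stronglyContinuous_defect (M := M) hU
  have h0 : edgeDefect U V M P 0 = 0 := by
    rw [edgeDefect, hU.zero, hV.evolution.zero, star_one, one_mul, one_mul, mul_one, mul_one,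
      sub_self, MulZeroClass.mul_zero, MulZeroClass.zero_mul]
  have hd := fun t ht => hV.deriv_defect (t := t) hU hM ht
  refine ⟨Confined.of_strongDeriv hU.countable hc h0 hd hXr hX, ?_⟩
  rw [← integral_opTrace_strongDeriv hU.countable hU.nonneg hc h0 hd hXr hX,
    ← intervalIntegral.integral_const_mul]
  refine intervalIntegral.integral_congr fun t ht => ?_
  rw [uIcc_of_le hU.nonneg] at ht
  rw [opTrace_smul, hQ.opTrace_conj hV.evolution.localized ht (hV.evolution.mul_star t),
    hV.opTrace_source hU hcc hM ht]
  ring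

/-- Bulk-edge correspondence for the integrated fluxes. -/
theorem IsLocalEvolution.integral_flux_eq (hU : IsLocalEvolution b Z T H U) (hper : U T = 1)
    (hcc : IsCoordPair c c') {Λ₁ Λ₁' Λ₂ Λ₂' : SwitchFunction} {L' M' : E →L[ℂ] E}
    (hL : IsSwitch b c Λ₁ L) (hL' : IsSwitch b c Λ₁' L') (hM : IsSwitch b c' Λ₂ M)
    (hM' : IsSwitch b c' Λ₂' M') :
    ∫ t in (0 : ℝ)..T, flux b H U L M t = ∫ t in (0 : ℝ)..T, flux b H U L' M' t := by
  -- Only the second argument can be changed directly; antisymmetry exchanges the roles of the two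
  -- to change the first.
  rw [hU.integral_flux_congr hper hcc hL hM hM', hU.integral_flux_antisymm hper hcc hL hM',
    hU.integral_flux_congr hper hcc.symm hM' hL hL',
    hU.integral_flux_antisymm hper hcc.symm hM' hL', neg_neg]

end Correspondence

/-! ### The site basis and a criterion for trace class. -/

section SiteBasis

variable {S : Type} [DecidableEq S] {N : ℕ}

theorem siteBasis_apply (p : S × Fin N) : siteBasis S N p = siteVec p := by
  simp [siteBasis]

theorem norm_absOp_apply {E : Type} [NormedAddCommGroup E] [InnerProductSpace ℂ E]
    [CompleteSpace E] (A : E →L[ℂ] E) (x : E) : ‖absOp A x‖ = ‖A x‖ := by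
  have hs : ContinuousLinearMap.adjoint (absOp A) = absOp A := by
    rw [← ContinuousLinearMap.star_eq_adjoint]
    exact (CFC.abs_nonneg A).isSelfAdjoint
  have h : absOp A * absOp A = star A * A := CFC.abs_mul_abs A
  have h1 : ⟪absOp A x, absOp A x⟫_ℂ = ⟪A x, A x⟫_ℂ := by
    rw [← ContinuousLinearMap.adjoint_inner_right, hs, ← mul_apply_eq_comp, h, mul_apply_eq_comp,
      ContinuousLinearMap.star_eq_adjoint, ContinuousLinearMap.adjoint_inner_right]
  rw [inner_self_eq_norm_sq_to_K, inner_self_eq_norm_sq_to_K] at h1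
  have h2 : ‖absOp A x‖ ^ 2 = ‖A x‖ ^ 2 := by exact_mod_cast h1
  exact (sq_eq_sq₀ (norm_nonneg _) (norm_nonneg _)).1 h2

/-- `⟨e, |A| e⟩ ≤ ‖|A| e‖ = ‖A e‖` for unit vectors `e`. -/
theorem isTraceClass_of_summable {A : SiteSpace S N →L[ℂ] SiteSpace S N}
    (h : Summable fun p => ‖A (siteBasis S N p)‖) : IsTraceClass A := by
  refine h.of_norm_bounded fun p => ?_
  refine (Complex.abs_re_le_norm _).trans ((norm_inner_le_norm _ _).trans_eq ?_)
  rw [(siteBasis S N).orthonormal.1 p, one_mul, norm_absOp_apply]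

theorem switchOp_siteBasis (c : S → ℤ) (Λ : SwitchFunction) (p : S × Fin N) :
    switchOp N c Λ (siteBasis S N p) = (Λ.toFun (c p.1) : ℂ) • siteBasis S N p := by
  rw [siteBasis_apply]
  ext n a
  rw [switchOp_apply, lp.coeFn_smul, Pi.smul_apply, siteVec, lp.single_apply]
  by_cases h : n = p.1
  · subst h; rfl
  · simp [h]

theorem isSwitch_switchOp (c : ℤ × ℤ → ℤ) (Λ : SwitchFunction) :
    IsSwitch (siteBasis (ℤ × ℤ) N) c Λ (switchOp N c Λ) := switchOp_siteBasis c Λ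

theorem norm_inner_siteBasis_le (K : SiteSpace S N →L[ℂ] SiteSpace S N) (p q : S × Fin N) :
    ‖⟪siteBasis S N p, K (siteBasis S N q)⟫_ℂ‖ ≤ ‖kernel K p.1 q.1‖ := by
  rw [siteBasis_apply, siteBasis_apply, siteVec, lp.inner_single_left]
  refine (norm_inner_le_norm _ _).trans ?_
  rw [PiLp.norm_single, norm_one, one_mul]
  have h := (kernel K p.1 q.1).le_opNorm (EuclideanSpace.single q.2 (1 : ℂ))
  rwa [PiLp.norm_single, norm_one, mul_one] at h

end SiteBasis

/-! ### From Hamiltonians and propagators to evolutions. -/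

section BulkEvolution

variable {N : ℕ} {T : ℝ} {H : ℝ → BulkSpace N →L[ℂ] BulkSpace N}

theorem IsBulkHamiltonian.localized (hH : IsBulkHamiltonian T H) :
    Localized (siteBasis (ℤ × ℤ) N) (Icc 0 T) 0 H := by
  obtain ⟨μ, hμ, C, hC, hb⟩ := hH.isLocal
  refine ⟨μ, hμ, C, hC.le, fun t ht p q => (norm_inner_siteBasis_le _ p q).trans ?_⟩
  rw [Pi.zero_apply, add_zero]
  exact hb t ht p.1 q.1

theorem IsBulkHamiltonian.exists_regular (hH : IsBulkHamiltonian T H) :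
    ∃ Z : Set ℝ, Z.Countable ∧ (∀ t ∉ Z, ∀ ψ, ContinuousAt (fun τ => H τ ψ) t) ∧
      StronglyRegular Z T H := by
  obtain ⟨Z, hZ, hc⟩ := exists_countable_stronglyContinuous (siteBasis (ℤ × ℤ) N)
    hH.piecewiseContinuous
  exact ⟨Z, hZ, hc, exists_opNorm_le_of_jumps hH.piecewiseContinuous 0 T,
    fun t ht => hc t ht.2⟩

variable {E : Type} [NormedAddCommGroup E] [InnerProductSpace ℂ E] [CompleteSpace E]
variable {G : ℝ → E →L[ℂ] E} {U : ℝ → ℝ → E →L[ℂ] E}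

theorem IsPropagator.star_eq (hU : IsPropagator G U) (t s : ℝ) : star (U t s) = U s t := by
  have h1 : U s t * U t s = 1 := by rw [hU.comp, hU.refl]
  calc star (U t s) = (U s t * U t s) * star (U t s) := by rw [h1, one_mul]
    _ = U s t := by rw [mul_assoc, (Unitary.mem_iff.1 (hU.unitary t s)).2, mul_one]

theorem IsPropagator.isEvolution (hU : IsPropagator G U) {Z : Set ℝ} (T : ℝ)
    (hc : ∀ t ∉ Z, ∀ ψ, ContinuousAt (fun τ => G τ ψ) t) :
    IsEvolution Z T G (fun t => U t 0) where
  unitary t := hU.unitary t 0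
  zero := hU.refl 0
  cont ψ := (hU.continuous ψ).comp (continuous_id.prodMk continuous_const)
  cont_star ψ := by
    have h : ∀ t, star (U t 0) ψ = U 0 t ψ := fun t => by rw [hU.star_eq]
    refine Continuous.congr ?_ fun t => (h t).symm
    exact (hU.continuous ψ).comp (continuous_const.prodMk continuous_id)
  deriv t ht ψ := by
    have h := (hU.schrodinger t 0 ψ (hc t ht.2)).fun_const_smul (-Complex.I)
    simp only [smul_smul, neg_mul, Complex.I_mul_I, neg_neg, one_smul] at h
    exact h

end BulkEvolution

/-! ### The half-space projection and the extended edge evolution. -/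

section HalfSpace

variable {N : ℕ}

theorem adjoint_inj_inj : ContinuousLinearMap.adjoint (inj N) ∘L inj N = 1 := by
  have h : ∀ f : EdgeSpace N, ‖inj N f‖ = ‖f‖ := fun f => by
    unfold inj
    rw [LinearIsometry.coe_toContinuousLinearMap, LinearIsometry.norm_map]
  exact (ContinuousLinearMap.norm_map_iff_adjoint_comp_self (inj N)).1 h

theorem adjoint_inj_inj_apply (f : EdgeSpace N) :
    ContinuousLinearMap.adjoint (inj N) (inj N f) = f := congrArg (· f) adjoint_inj_inj

/-- The embedding of the edge states into the bulk states. -/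
def stateIncl (p : (ℕ × ℤ) × Fin N) : (ℤ × ℤ) × Fin N := (siteIncl p.1, p.2)

theorem stateIncl_injective : Function.Injective (stateIncl (N := N)) := fun p q h => by
  have h1 := siteIncl_injective (congrArg Prod.fst h)
  exact Prod.ext h1 (congrArg (fun x : (ℤ × ℤ) × Fin N => x.2) h)

theorem inj_siteBasis (p : (ℕ × ℤ) × Fin N) :
    inj N (siteBasis (ℕ × ℤ) N p) = siteBasis (ℤ × ℤ) N (stateIncl p) := by
  rw [siteBasis_apply, siteBasis_apply]
  ext n a
  change Function.extend siteIncl (⇑(siteVec p : EdgeSpace N)) 0 n a = _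
  rw [siteVec, siteVec, lp.single_apply]
  by_cases h : ∃ k, siteIncl k = n
  · obtain ⟨k, rfl⟩ := h
    rw [siteIncl_injective.extend_apply, lp.single_apply]
    by_cases hk : k = p.1
    · subst hk; simp [stateIncl]
    · have hk' : siteIncl k ≠ siteIncl p.1 := fun h => hk (siteIncl_injective h)
      simp [stateIncl, hk, hk']
  · rw [Function.extend_apply' _ _ _ h]
    have hn : n ≠ siteIncl p.1 := fun h' => h ⟨p.1, h'.symm⟩
    simp [stateIncl, hn]

theorem adjoint_inj_siteBasis_of_notMem {q : (ℤ × ℤ) × Fin N} (hq : q ∉ range (stateIncl (N := N))) :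
    ContinuousLinearMap.adjoint (inj N) (siteBasis (ℤ × ℤ) N q) = 0 := by
  refine (siteBasis (ℕ × ℤ) N).repr.injective ?_
  ext p
  rw [HilbertBasis.repr_apply_apply, ContinuousLinearMap.adjoint_inner_right, inj_siteBasis,
    inner_basis, if_neg (fun h => hq ⟨p, h⟩), map_zero]
  rfl

theorem mem_range_stateIncl (q : (ℤ × ℤ) × Fin N) :
    q ∈ range (stateIncl (N := N)) ↔ 0 ≤ q.1.1 := by
  constructor
  · rintro ⟨p, rfl⟩
    exact Int.natCast_nonneg _
  · intro h
    refine ⟨((q.1.1.toNat, q.1.2), q.2), ?_⟩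
    simp [stateIncl, siteIncl, Int.toNat_of_nonneg h]

/-- The unit step. -/
noncomputable def stepFunction : SwitchFunction where
  toFun n := if 0 ≤ n then 1 else 0
  eventually_one := (eventually_ge_atTop 0).mono fun _ hn => if_pos hn
  eventually_zero := (eventually_lt_atBot 0).mono fun _ hn => if_neg (not_le.2 hn)

/-- The projection onto the half space. -/
noncomputable def halfSpace (N : ℕ) : BulkSpace N →L[ℂ] BulkSpace N :=
  inj N ∘L ContinuousLinearMap.adjoint (inj N)

/-- The edge enters the bulk picture here: cutting at the boundary is one particular choice of the
switch function in direction 1. -/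
theorem isSwitch_halfSpace : IsSwitch (siteBasis (ℤ × ℤ) N) Prod.fst stepFunction (halfSpace N) := by
  intro q
  simp only [halfSpace, ContinuousLinearMap.comp_apply, stepFunction]
  by_cases h : q ∈ range (stateIncl (N := N))
  · rw [if_pos ((mem_range_stateIncl q).1 h)]
    obtain ⟨p, rfl⟩ := h
    rw [← inj_siteBasis, adjoint_inj_inj_apply, Complex.ofReal_one, one_smul]
  · rw [if_neg (fun h' => h ((mem_range_stateIncl q).2 h')), adjoint_inj_siteBasis_of_notMem h,
      map_zero, Complex.ofReal_zero, zero_smul]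

theorem halfSpace_inj (f : EdgeSpace N) : halfSpace N (inj N f) = inj N f := by
  rw [halfSpace, ContinuousLinearMap.comp_apply, adjoint_inj_inj_apply]

theorem adjoint_inj_halfSpace (ψ : BulkSpace N) :
    ContinuousLinearMap.adjoint (inj N) (halfSpace N ψ) = ContinuousLinearMap.adjoint (inj N) ψ := by
  rw [halfSpace, ContinuousLinearMap.comp_apply, adjoint_inj_inj_apply]

theorem halfSpace_mul_self : halfSpace N * halfSpace N = halfSpace N :=
  ContinuousLinearMap.ext fun _ => halfSpace_inj _

/-- The extension of an operator on the edge space by the identity on the complementary half space. -/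
noncomputable def extendOne (K : EdgeSpace N →L[ℂ] EdgeSpace N) : BulkSpace N →L[ℂ] BulkSpace N :=
  inj N ∘L K ∘L ContinuousLinearMap.adjoint (inj N) + (1 - halfSpace N)

theorem extendOne_apply (K : EdgeSpace N →L[ℂ] EdgeSpace N) (ψ : BulkSpace N) :
    extendOne K ψ = inj N (K (ContinuousLinearMap.adjoint (inj N) ψ)) + (ψ - halfSpace N ψ) := rfl

theorem extendOne_inj (K : EdgeSpace N →L[ℂ] EdgeSpace N) (f : EdgeSpace N) :
    extendOne K (inj N f) = inj N (K f) := by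
  rw [extendOne_apply, adjoint_inj_inj_apply, halfSpace_inj, sub_self, add_zero]

theorem adjoint_inj_extendOne (K : EdgeSpace N →L[ℂ] EdgeSpace N) (ψ : BulkSpace N) :
    ContinuousLinearMap.adjoint (inj N) (extendOne K ψ) =
      K (ContinuousLinearMap.adjoint (inj N) ψ) := by
  rw [extendOne_apply, map_add, map_sub, adjoint_inj_inj_apply, adjoint_inj_halfSpace, sub_self,
    add_zero]

theorem halfSpace_extendOne (K : EdgeSpace N →L[ℂ] EdgeSpace N) :
    halfSpace N * extendOne K = extendOne K * halfSpace N := by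
  ext1 ψ
  rw [mul_apply_eq_comp, mul_apply_eq_comp]
  conv_lhs => rw [halfSpace, ContinuousLinearMap.comp_apply, adjoint_inj_extendOne]
  conv_rhs => rw [halfSpace, ContinuousLinearMap.comp_apply, extendOne_inj]

theorem extendOne_one : extendOne (1 : EdgeSpace N →L[ℂ] EdgeSpace N) = 1 := by
  ext1 ψ
  rw [extendOne_apply]
  exact add_sub_cancel _ _

theorem extendOne_mul (K K' : EdgeSpace N →L[ℂ] EdgeSpace N) :
    extendOne (K * K') = extendOne K * extendOne K' := by
  ext1 ψ
  have h : halfSpace N (extendOne K' ψ) = inj N (K' (ContinuousLinearMap.adjoint (inj N) ψ)) := by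
    rw [halfSpace, ContinuousLinearMap.comp_apply, adjoint_inj_extendOne]
  rw [mul_apply_eq_comp, extendOne_apply K (extendOne K' ψ), adjoint_inj_extendOne, h,
    extendOne_apply K' ψ, add_sub_cancel_left]
  rfl

theorem star_halfSpace : star (halfSpace N) = halfSpace N :=
  IsDiagonal.isSelfAdjoint isSwitch_halfSpace

theorem star_extendOne (K : EdgeSpace N →L[ℂ] EdgeSpace N) :
    star (extendOne K) = extendOne (star K) := by
  rw [extendOne, extendOne, star_add, star_sub, star_one, star_halfSpace]
  congr 1
  rw [ContinuousLinearMap.star_eq_adjoint, ContinuousLinearMap.adjoint_comp,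
    ContinuousLinearMap.adjoint_comp, ContinuousLinearMap.adjoint_adjoint,
    ContinuousLinearMap.star_eq_adjoint]
  rfl

theorem extendOne_mem_unitary {K : EdgeSpace N →L[ℂ] EdgeSpace N}
    (h : K ∈ unitary (EdgeSpace N →L[ℂ] EdgeSpace N)) :
    extendOne K ∈ unitary (BulkSpace N →L[ℂ] BulkSpace N) := by
  rw [Unitary.mem_iff] at h ⊢
  rw [star_extendOne, ← extendOne_mul, ← extendOne_mul, h.1, h.2, extendOne_one]
  exact ⟨rfl, rfl⟩

theorem continuous_extendOne {K : ℝ → EdgeSpace N →L[ℂ] EdgeSpace N}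
    (h : ∀ ψ, Continuous fun t => K t ψ) (ψ : BulkSpace N) :
    Continuous fun t => extendOne (K t) ψ := by
  simp only [extendOne_apply]
  exact ((inj N).continuous.comp (h _)).add continuous_const

/-- On the half space this is the edge equation carried over by `inj`; on the complement the
extension is constant and `P H P` vanishes. -/
theorem isEvolution_extendOne {Z : Set ℝ} {T : ℝ} {H : ℝ → BulkSpace N →L[ℂ] BulkSpace N}
    {K : ℝ → EdgeSpace N →L[ℂ] EdgeSpace N} (hK : IsEvolution Z T (edgeHamiltonian H) K) :
    IsEvolution Z T (fun t => halfSpace N * H t * halfSpace N) (fun t => extendOne (K t)) where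
  unitary t := extendOne_mem_unitary (hK.unitary t)
  zero := by rw [hK.zero, extendOne_one]
  cont ψ := continuous_extendOne hK.cont ψ
  cont_star ψ := by
    simp only [star_extendOne]
    exact continuous_extendOne hK.cont_star ψ
  deriv t ht ψ := by
    have h1 := ((inj N).restrictScalars ℝ).hasFDerivAt.comp_hasDerivAt t
      (hK.deriv t ht (ContinuousLinearMap.adjoint (inj N) ψ))
    have h2 := h1.add_const (ψ - halfSpace N ψ)
    refine h2.congr_deriv ?_
    have h3 : halfSpace N (extendOne (K t) ψ) =
        inj N (K t (ContinuousLinearMap.adjoint (inj N) ψ)) := by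
      rw [halfSpace, ContinuousLinearMap.comp_apply, adjoint_inj_extendOne]
    simp only [ContinuousLinearMap.coe_restrictScalars', smul_apply, mul_apply_eq_comp, map_smul,
      h3]
    rfl

end HalfSpace

/-! ### Identification of the two indices. -/

section Indices

variable {N : ℕ} {T : ℝ} {Z : Set ℝ} {H U : ℝ → BulkSpace N →L[ℂ] BulkSpace N}
variable {UB : ℝ → ℝ → BulkSpace N →L[ℂ] BulkSpace N}
variable {UE : ℝ → ℝ → EdgeSpace N →L[ℂ] EdgeSpace N}

theorem adjoint_inj_switchOp_inj (Λ : SwitchFunction) (f : EdgeSpace N) :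
    ContinuousLinearMap.adjoint (inj N) (switchOp N (fun n : ℤ × ℤ => n.2) Λ (inj N f)) =
      switchOp N (fun n : ℕ × ℤ => n.2) Λ f := by
  have h : ContinuousLinearMap.adjoint (inj N) ∘L switchOp N (fun n : ℤ × ℤ => n.2) Λ ∘L inj N =
      switchOp N (fun n : ℕ × ℤ => n.2) Λ := by
    refine clm_ext_basis (b := siteBasis (ℕ × ℤ) N) fun p => ?_
    rw [ContinuousLinearMap.comp_apply, ContinuousLinearMap.comp_apply, inj_siteBasis,
      switchOp_siteBasis, switchOp_siteBasis, map_smul, ← inj_siteBasis, adjoint_inj_inj_apply]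
    rfl
  exact congrArg (· f) h

/-- `U T = 1` removes the bulk evolution from the defect, which leaves `P (V* M V - M) P`. -/
theorem edgeOp_eq (hu : UE T 0 ∈ unitary (EdgeSpace N →L[ℂ] EdgeSpace N)) (hU : U T = 1)
    (Λ : SwitchFunction) (f : EdgeSpace N) :
    edgeOp T UE Λ f = ContinuousLinearMap.adjoint (inj N)
      (edgeDefect U (fun t => extendOne (UE t 0)) (switchOp N (fun n : ℤ × ℤ => n.2) Λ)
        (halfSpace N) T (inj N f)) := by
  have h1 : edgeOp T UE Λ = star (UE T 0) * (switchOp N (fun n : ℕ × ℤ => n.2) Λ * UE T 0) -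
      switchOp N (fun n : ℕ × ℤ => n.2) Λ := by
    rw [edgeOp, Ring.lie_def, mul_sub, ← mul_assoc (star (UE T 0)) (UE T 0),
      (Unitary.mem_iff.1 hu).1, one_mul]
  rw [h1, edgeDefect, hU, star_one, mul_one, one_mul, star_extendOne]
  simp only [mul_apply_eq_comp, sub_apply, map_sub, adjoint_inj_halfSpace, halfSpace_inj,
    extendOne_inj, adjoint_inj_extendOne, adjoint_inj_switchOp_inj]

theorem summable_norm_edgeOp (hu : UE T 0 ∈ unitary (EdgeSpace N →L[ℂ] EdgeSpace N)) (hU : U T = 1)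
    (Λ : SwitchFunction)
    (h : Summable fun q => ‖edgeDefect U (fun t => extendOne (UE t 0))
      (switchOp N (fun n : ℤ × ℤ => n.2) Λ) (halfSpace N) T (siteBasis (ℤ × ℤ) N q)‖) :
    Summable fun p => ‖edgeOp T UE Λ (siteBasis (ℕ × ℤ) N p)‖ := by
  refine Summable.of_nonneg_of_le (fun _ => norm_nonneg _) (fun p => ?_)
    (h.comp_injective stateIncl_injective)
  rw [edgeOp_eq hu hU, inj_siteBasis]
  refine (ContinuousLinearMap.le_opNorm _ _).trans (mul_le_of_le_one_left (norm_nonneg _) ?_)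
  rw [LinearIsometryEquiv.norm_map]
  exact LinearIsometry.norm_toContinuousLinearMap_le _

theorem trace_edgeOp (hu : UE T 0 ∈ unitary (EdgeSpace N →L[ℂ] EdgeSpace N)) (hU : U T = 1)
    (Λ : SwitchFunction) :
    trace (edgeOp T UE Λ) = opTrace (siteBasis (ℤ × ℤ) N) (edgeDefect U
      (fun t => extendOne (UE t 0)) (switchOp N (fun n : ℤ × ℤ => n.2) Λ) (halfSpace N) T) := by
  rw [trace, opTrace, ← stateIncl_injective.tsum_eq]
  · refine tsum_congr fun p => ?_
    rw [edgeOp_eq hu hU, ContinuousLinearMap.adjoint_inner_right, inj_siteBasis]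
  -- Basis vectors outside the half space are killed by the rightmost `P`, so only edge states
  -- contribute to the bulk sum.
  · intro q hq
    by_contra hn
    refine hq ?_
    have h0 : halfSpace N (siteBasis (ℤ × ℤ) N q) = 0 := by
      rw [halfSpace, ContinuousLinearMap.comp_apply, adjoint_inj_siteBasis_of_notMem hn, map_zero]
    change ⟪_, edgeDefect _ _ _ _ _ _⟫_ℂ = 0
    rw [edgeDefect, mul_apply_eq_comp, h0, map_zero, inner_zero_right]

theorem bulkOp_eq (hU : IsEvolution Z T H (fun t => UB t 0)) (Λ₁ Λ₂ : SwitchFunction) (t : ℝ) :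
    bulkOp UB Λ₁ Λ₂ t = star (UB t 0) * strongDeriv (fun τ => UB τ 0) t *
      (heisenberg (fun t => UB t 0) (switchOp N (fun n : ℤ × ℤ => n.1) Λ₁) t *
        heisenberg (fun t => UB t 0) (switchOp N (fun n : ℤ × ℤ => n.2) Λ₂) t -
      heisenberg (fun t => UB t 0) (switchOp N (fun n : ℤ × ℤ => n.2) Λ₂) t *
        heisenberg (fun t => UB t 0) (switchOp N (fun n : ℤ × ℤ => n.1) Λ₁) t) := by
  rw [hU.heisenberg_eq, hU.heisenberg_eq, bulkOp, Ring.lie_def, Ring.lie_def, Ring.lie_def]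

theorem IsLocalEvolution.ae_trace_bulkOp
    (hU : IsLocalEvolution (siteBasis (ℤ × ℤ) N) Z T H (fun t => UB t 0)) (Λ₁ Λ₂ : SwitchFunction) :
    ∀ᵐ t ∂volume, t ∈ uIoc 0 T → trace (bulkOp UB Λ₁ Λ₂ t) = -Complex.I *
      (flux (siteBasis (ℤ × ℤ) N) H (fun t => UB t 0) (switchOp N (fun n : ℤ × ℤ => n.1) Λ₁)
        (switchOp N (fun n : ℤ × ℤ => n.2) Λ₂) t -
      flux (siteBasis (ℤ × ℤ) N) H (fun t => UB t 0) (switchOp N (fun n : ℤ × ℤ => n.2) Λ₂)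
        (switchOp N (fun n : ℤ × ℤ => n.1) Λ₁) t) := by
  -- The end point `T` is discarded too, since the evolution equation is only available on the open
  -- interval.
  have hnull := (hU.countable.union (countable_singleton T)).measure_zero volume
  filter_upwards [measure_eq_zero_iff_ae_notMem.1 hnull] with t ht htm
  rw [uIoc_of_le hU.nonneg] at htm
  simp only [mem_union, mem_singleton_iff, not_or] at ht
  have htZ : t ∈ Ioo 0 T \ Z := ⟨⟨htm.1, lt_of_le_of_ne htm.2 ht.2⟩, ht.1⟩
  rw [bulkOp_eq hU.toIsEvolution, (hU.deriv t htZ).strongDeriv_eq]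
  exact hU.opTrace_bulk isCoordPair_fst_snd (isSwitch_switchOp _ _) (isSwitch_switchOp _ _)
    (Ioo_subset_Icc_self htZ.1)

theorem bulkEdgeCorrespondence (N : ℕ) (T : ℝ) (hT : 0 < T)
    (H : ℝ → BulkSpace N →L[ℂ] BulkSpace N)
    (hH : IsBulkHamiltonian T H)
    (UB : ℝ → ℝ → BulkSpace N →L[ℂ] BulkSpace N)
    (hUB : IsPropagator H UB)
    (UE : ℝ → ℝ → EdgeSpace N →L[ℂ] EdgeSpace N)
    (hUE : IsPropagator (edgeHamiltonian H) UE)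
    (hper : UB T 0 = 1)
    (Λ₁ Λ₂ Λ₂' : SwitchFunction) :
    (∀ t ∈ Icc 0 T, IsTraceClass (bulkOp UB Λ₁ Λ₂ t)) ∧
    IntervalIntegrable (fun t => trace (bulkOp UB Λ₁ Λ₂ t))
      volume 0 T ∧
    IsTraceClass (edgeOp T UE Λ₂') ∧
    bulkIndex T UB Λ₁ Λ₂ = edgeIndex T UE Λ₂' := by
  obtain ⟨Z, hZ, hc, hreg⟩ := hH.exists_regular
  have hloc := hH.localized
  have hev : IsEvolution Z T H (fun t => UB t 0) := hUB.isEvolution T hc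
  have hU : IsLocalEvolution (siteBasis (ℤ × ℤ) N) Z T H (fun t => UB t 0) :=
    ⟨hev, hZ, hT.le, hreg, hloc, hev.localized hZ hreg hloc⟩
  have hcE : ∀ t ∉ Z, ∀ ψ, ContinuousAt (fun τ => edgeHamiltonian H τ ψ) t := fun t ht ψ =>
    (ContinuousLinearMap.adjoint (inj N)).continuous.continuousAt.comp (hc t ht (inj N ψ))
  have hevV := isEvolution_extendOne (hUE.isEvolution T hcE)
  have hPs : IsSwitch (siteBasis (ℤ × ℤ) N) Prod.fst stepFunction (halfSpace N) :=
    isSwitch_halfSpace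
  have hregV : StronglyRegular Z T (fun t => halfSpace N * H t * halfSpace N) :=
    ((stronglyRegular_const _).mul hreg).mul (stronglyRegular_const _)
  have hlocV : Localized (siteBasis (ℤ × ℤ) N) (Icc 0 T) 0
      (fun t => halfSpace N * H t * halfSpace N) :=
    Localized.mul_zero (F := fun t => halfSpace N * H t) (G := fun _ => halfSpace N)
      (Localized.zero_mul (F := fun _ => halfSpace N) hPs.localized hloc isWeight_zero)
      hPs.localized isWeight_zero
  have hV : IsEdgeEvolution (siteBasis (ℤ × ℤ) N) Prod.fst stepFunction Z T H
      (fun t => extendOne (UE t 0)) (halfSpace N) :=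
    ⟨hPs, halfSpace_mul_self, ⟨hevV, hZ, hT.le, hregV, hlocV, hevV.localized hZ hregV hlocV⟩,
      fun t => halfSpace_extendOne _⟩
  have h1 : IsSwitch (siteBasis (ℤ × ℤ) N) Prod.fst Λ₁ (switchOp N (fun n : ℤ × ℤ => n.1) Λ₁) :=
    isSwitch_switchOp _ _
  have h2 : IsSwitch (siteBasis (ℤ × ℤ) N) Prod.snd Λ₂ (switchOp N (fun n : ℤ × ℤ => n.2) Λ₂) :=
    isSwitch_switchOp _ _
  have h2' : IsSwitch (siteBasis (ℤ × ℤ) N) Prod.snd Λ₂'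
      (switchOp N (fun n : ℤ × ℤ => n.2) Λ₂') := isSwitch_switchOp _ _
  have hcc := isCoordPair_fst_snd
  obtain ⟨hD, hDt⟩ := hV.opTrace_defect hU hcc h2'
  have hu := hUE.unitary T 0
  have hae := hU.ae_trace_bulkOp Λ₁ Λ₂
  have hI1 := hU.intervalIntegrable_flux hcc h1 h2
  have hI2 := hU.intervalIntegrable_flux hcc.symm h2 h1
  refine ⟨fun t ht => ?_, ?_, ?_, ?_⟩
  · refine isTraceClass_of_summable ?_
    -- The commutator alone is summable on the basis and the factor to its left is merely bounded.
    -- This covers every `t`, including the exceptional times.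
    have hs := ((hU.confined_heisenberg_lie hcc h1 h2).summable_norm_apply ht).mul_left
      ‖star (UB t 0) * strongDeriv (fun τ => UB τ 0) t‖
    refine Summable.of_nonneg_of_le (fun _ => norm_nonneg _) (fun p => ?_) hs
    rw [bulkOp_eq hev, mul_apply_eq_comp]
    exact ContinuousLinearMap.le_opNorm _ _
  · refine ((hI1.sub hI2).const_mul (-Complex.I)).congr_ae ?_
    exact (ae_restrict_iff' measurableSet_uIoc).2
      (hae.mono fun t ht htm => (ht htm).symm)
  · exact isTraceClass_of_summable (summable_norm_edgeOp (U := fun t => UB t 0) hu hper Λ₂'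
      (hD.summable_norm_apply ⟨hT.le, le_rfl⟩))
  · rw [bulkIndex, edgeIndex, trace_edgeOp (U := fun t => UB t 0) hu hper, hDt,
      intervalIntegral.integral_congr_ae hae, intervalIntegral.integral_const_mul,
      -- Antisymmetry makes the two fluxes in the bulk index contribute equally, which cancels the
      -- factor `1 / 2`; then `Λ₁` is exchanged for the half-space step and `Λ₂` for `Λ₂'`.
      intervalIntegral.integral_sub hI1 hI2, hU.integral_flux_antisymm hper hcc.symm h2 h1,
      hU.integral_flux_eq hper hcc h1 hPs h2 h2']
    ring

end Indices

end Floquet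

theorem mainTheorem2 (N : ℕ) (T : ℝ) (hT : 0 < T)
    (H : ℝ → Floquet.BulkSpace N →L[ℂ] Floquet.BulkSpace N)
    (hH : Floquet.IsBulkHamiltonian T H)
    (UB : ℝ → ℝ → Floquet.BulkSpace N →L[ℂ] Floquet.BulkSpace N)
    (hUB : Floquet.IsPropagator H UB)
    (UE : ℝ → ℝ → Floquet.EdgeSpace N →L[ℂ] Floquet.EdgeSpace N)
    (hUE : Floquet.IsPropagator (Floquet.edgeHamiltonian H) UE)
    (hper : UB T 0 = 1)
    (Λ₁ Λ₂ Λ₂' : Floquet.SwitchFunction) :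
    (∀ t ∈ Set.Icc 0 T, Floquet.IsTraceClass (Floquet.bulkOp UB Λ₁ Λ₂ t)) ∧
    IntervalIntegrable (fun t => Floquet.trace (Floquet.bulkOp UB Λ₁ Λ₂ t))
      MeasureTheory.volume 0 T ∧
    Floquet.IsTraceClass (Floquet.edgeOp T UE Λ₂') ∧
    Floquet.bulkIndex T UB Λ₁ Λ₂ = Floquet.edgeIndex T UE Λ₂' :=
  Floquet.bulkEdgeCorrespondence N T hT H hH UB hUB UE hUE hper Λ₁ Λ₂ Λ₂'
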